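/- For graphs $F,G$ let $\mathcal N(F,G)$ denote the number of subgraphs of $G$ isomorphic to $F$. For integers $t\ge 2$, $2<r<2+t$, $n\ge 0$ and a real $k>0$ put \[ A=k^{\frac{t}{r-2}}n^{3/2},\qquad D=k^{\frac{2t^2}{(2t-1)(r-2)+t}}\,n^{\frac{(3t-2)(r-2)+2t}{(2t-1)(r-2)+t}} .\] For every integer $t\ge 2$ there is a constant $k_0=k_0(t)$ such that for every integer $r$ with $2<r<2+t$ the following hold. (1) There is a constant $c=c(t,r)>0$ such that every $n$-vertex graph $G$ with $\mathcal N(K_r,G)=kn^{3/2}$ and $k\ge k_0$ satisfies $\mathcal N(K_{2,t},G)\ge c\min\{A,D\}$. (2) There are constants $c,C>0$ depending only on $t$ and $r$ such that for all $n$ and all real $k>0$ with $kn^{3/2}\le\binom nr$ there is an $n$-vertex graph $G$ with $\mathcal N(K_r,G)\ge c\,kn^{3/2}$ and $\mathcal N(K_{2,t},G)\le C\,D$. (3) For every $b>0$ there are constants $k_1$ and $c,C>0$ depending only on $t,r,b$ such that the following holds for all $n$ and all real $k>0$ with $k\ge k_1$. Suppose there is a bipartite graph $B$ with parts $U,V$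 such that $|U|\le k^{-2/(r-2)}n^{3/2}$, $|V|=n$, $e(B)\ge b\,k^{-1/(r-2)}n^{3/2}$, and any two distinct vertices of $V$ are joined by fewer than $t$ paths of length at most $4$ in $B$. Then there is an $n$-vertex graph $G$ with $\mathcal N(K_r,G)\ge c\,kn^{3/2}$ and $\mathcal N(K_{2,t},G)\le C\min\{A,D\}$. -/

import Mathlib

/-- The number of subgraphs of `G` isomorphic to the complete graph `K_r`. -/
noncomputable def numCliques {n : ℕ} (r : ℕ) (G : SimpleGraph (Fin n)) : ℕ :=
  G.copyCount (⊤ : SimpleGraph (Fin r))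

/-- The number of subgraphs of `G` isomorphic to the complete bipartite graph `K_{2,t}`. -/
noncomputable def numK2 {n : ℕ} (t : ℕ) (G : SimpleGraph (Fin n)) : ℕ :=
  G.copyCount (completeBipartiteGraph (Fin 2) (Fin t))

/-- `k^{t/(r-2)} n^{3/2}`. -/
noncomputable def sparseBound (t r n : ℕ) (k : ℝ) : ℝ :=
  k ^ ((t : ℝ) / ((r : ℝ) - 2)) * (n : ℝ) ^ ((3 : ℝ) / 2)

/-- `k^{2t²/((2t-1)(r-2)+t)} n^{((3t-2)(r-2)+2t)/((2t-1)(r-2)+t)}`. -/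
noncomputable def denseBound (t r n : ℕ) (k : ℝ) : ℝ :=
  k ^ ((2 * (t : ℝ) ^ 2) / ((2 * (t : ℝ) - 1) * ((r : ℝ) - 2) + t)) *
    (n : ℝ) ^ (((3 * (t : ℝ) - 2) * ((r : ℝ) - 2) + 2 * t) /
      ((2 * (t : ℝ) - 1) * ((r : ℝ) - 2) + t))

/-- Any two distinct vertices of the second part of `B` are joined by fewer than `t` paths of
length at most `4`. -/
def FewShortPaths {m n : ℕ} (t : ℕ) (B : SimpleGraph (Fin m ⊕ Fin n)) : Prop :=
  ∀ v w : Fin n, v ≠ w →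
    {p : B.Path (Sum.inr v) (Sum.inr w) | p.1.length ≤ 4}.encard < t

/-- There is a bipartite graph `B` with parts `U`, `V` such that `|U| ≤ k^{-2/(r-2)} n^{3/2}`,
`|V| = n`, `e(B) ≥ c k^{-1/(r-2)} n^{3/2}`, and any two vertices of `V` are joined by fewer than
`t` paths of length at most `4`. -/
def ExistsSuitableBipartite (t r n : ℕ) (k c : ℝ) : Prop :=
  ∃ (m : ℕ) (B : SimpleGraph (Fin m ⊕ Fin n)),
    B ≤ completeBipartiteGraph (Fin m) (Fin n) ∧
    (m : ℝ) ≤ k ^ (-2 / ((r : ℝ) - 2)) * (n : ℝ) ^ ((3 : ℝ) / 2) ∧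
    c * (k ^ (-1 / ((r : ℝ) - 2)) * (n : ℝ) ^ ((3 : ℝ) / 2)) ≤ (B.edgeSet.ncard : ℝ) ∧
    FewShortPaths t B

/-! Write s = r - 2, K = k n^{3/2}, let e be the number of ordered adjacent pairs and X the number
of pairs (ordered vertex pair, t-set of its common neighbours). X is at most a constant times the
number of K_{2,t} (`sum_choose_commonNbrs_le`).

Lower bound. An r-clique is an edge together with s common neighbours of its ends, so K is at most
the sum of C(codegree, s) over edges. Cutting the codegrees at a level L gives K ≤ e L^s + O(X /
L^{t-s}); the same cut in Cauchy–Schwarz gives e² ≤ n (n² L + O(X / L^{t-1}) + e). If e =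
O(n^{3/2}), then L of order k^{1/s} gives X ≳ A. If e is larger, the second inequality gives X ≳ n²
(e²/n³)^t, and playing this against the first one gives X ≳ D.

The exponents of D become transparent through w and ρ defined by K = w ρ^s n^r and ρ^t = w^{2t-1}:
then D = n^{t+2} w^{2t} (`exists_density_params`). Here w is an edge density and ρn a clique size.
The relation says that a K_{2,t} inside one clique is as likely as one whose 2t edges lie in
different cliques.

Unconditional construction. Split the vertices into d ≈ ρn classes of size M ≈ 1/ρ, and take N ≈
w/ρ² random transversals (blocks) as cliques. A first-moment count (`sum_card_patterns_le`) bounds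
the K_{2,t} by O(D), because every way of distributing the 2t edges over blocks has weight at most
w^{2t} (`block_weight_le`, `incidence_weight_le`). When ρn is below a constant, blocks of exactly r
< t + 2 vertices are used, and deleting one block per surviving pattern leaves a K_{2,t}-free graph.

Conditional construction. Cut the neighbourhoods of the vertices of U into chunks of size about
k^{1/s} and make each chunk a clique. The path condition forces the two centres of every K_{2,t}
into a common chunk (`IsChunking.numK2_le`), which gives O(A). If D is smaller than A, the
unconditional construction serves instead. -/

open Finset

/-! ### Subgraph counts in terms of vertex sets and common neighbours. -/

/-- `v` is a labelled copy of `K_{2,t}` in `G`. -/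
def IsLabelledK2 {V : Type*} {t : ℕ} (G : SimpleGraph V) (v : Fin 2 ⊕ Fin t → V) : Prop :=
  Function.Injective v ∧ ∀ i j, G.Adj (v (.inl i)) (v (.inr j))

open Classical in
theorem numCliques_eq_card {n : ℕ} (r : ℕ) (G : SimpleGraph (Fin n)) :
    numCliques r G = #{R : Finset (Fin n) | G.IsNClique r R} := by
  rw [numCliques, SimpleGraph.copyCount]
  apply Finset.card_bij (fun G' _ => G'.verts.toFinset)
  · intro G' hG'
    simp only [mem_filter, mem_univ, true_and] at hG' ⊢
    obtain ⟨e⟩ := hG'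
    rw [SimpleGraph.isNClique_iff]
    constructor
    · intro a ha b hb hab
      simp only [Set.coe_toFinset] at ha hb
      have := e.symm.map_rel_iff (a := ⟨a, ha⟩) (b := ⟨b, hb⟩)
      apply G'.adj_sub
      rw [← SimpleGraph.Subgraph.coe_adj G' ⟨a, ha⟩ ⟨b, hb⟩, ← this]
      rw [SimpleGraph.top_adj]
      intro h
      exact hab (congrArg Subtype.val (e.symm.injective h))
    · rw [Set.toFinset_card, ← Fintype.card_congr e.toEquiv, Fintype.card_fin]
  · intro G₁ h₁ G₂ h₂ h
    simp only [mem_filter, mem_univ, true_and] at h₁ h₂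
    have hv : G₁.verts = G₂.verts := by simpa using h
    have key : ∀ G' : G.Subgraph, Nonempty ((⊤ : SimpleGraph (Fin r)) ≃g G'.coe) →
        ∀ a b, G'.Adj a b ↔ a ∈ G'.verts ∧ b ∈ G'.verts ∧ a ≠ b := by
      rintro G' ⟨e⟩ a b
      constructor
      · intro h
        exact ⟨h.fst_mem, h.snd_mem, h.ne⟩
      · rintro ⟨ha, hb, hab⟩
        have := e.symm.map_rel_iff (a := ⟨a, ha⟩) (b := ⟨b, hb⟩)
        rw [← SimpleGraph.Subgraph.coe_adj G' ⟨a, ha⟩ ⟨b, hb⟩, ← this, SimpleGraph.top_adj]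
        intro h
        exact hab (congrArg Subtype.val (e.symm.injective h))
    ext a b
    · rw [hv]
    · rw [key _ h₁, key _ h₂, hv]
  · intro R hR
    simp only [mem_filter, mem_univ, true_and] at hR
    let f : (⊤ : SimpleGraph (Fin r)).Copy G :=
      ⟨⟨fun i => R.equivFinOfCardEq hR.card_eq |>.symm i, fun {a b} hab =>
        hR.isClique (by simp) (by simp) (by
          intro h
          exact hab (by simpa using Subtype.ext h))⟩, fun a b h => by
            simpa using Subtype.ext h⟩
    refine ⟨f.toSubgraph, ?_, ?_⟩
    · simp only [mem_filter, mem_univ, true_and]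
      exact ⟨f.isoToSubgraph⟩
    · ext x
      simp only [SimpleGraph.Subgraph.map_verts, Set.mem_toFinset, Set.mem_image]
      constructor
      · rintro ⟨i, -, rfl⟩
        exact (R.equivFinOfCardEq hR.card_eq |>.symm i).2
      · intro hx
        exact ⟨R.equivFinOfCardEq hR.card_eq ⟨x, hx⟩, by simp, by simp [f]⟩

theorem labelledCopyCount_eq_natCard {V W : Type*} [Fintype V] [Fintype W] (G : SimpleGraph V)
    (H : SimpleGraph W) : G.labelledCopyCount H = Nat.card (H.Copy G) := by
  classical
  rw [SimpleGraph.labelledCopyCount, Nat.card_eq_fintype_card]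

open Classical in
theorem numK2_le_card {n : ℕ} (t : ℕ) (G : SimpleGraph (Fin n)) :
    numK2 t G ≤ #{v : Fin 2 ⊕ Fin t → Fin n | IsLabelledK2 G v} := by
  let φ : (completeBipartiteGraph (Fin 2) (Fin t)).Copy G →
      {v : Fin 2 ⊕ Fin t → Fin n // IsLabelledK2 G v} := fun f =>
    ⟨f, f.injective, fun i j => f.toHom.map_adj (by simp)⟩
  have hφ : Function.Injective φ := fun f g h => DFunLike.coe_injective (congrArg Subtype.val h)
  rw [← Fintype.card_subtype, ← Nat.card_eq_fintype_card]
  calc numK2 t G ≤ G.labelledCopyCount (completeBipartiteGraph (Fin 2) (Fin t)) :=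
        SimpleGraph.copyCount_le_labelledCopyCount
    _ = _ := labelledCopyCount_eq_natCard _ _
    _ ≤ _ := Nat.card_le_card_of_injective φ hφ

/-- The common neighbours of `u` and `v`. -/
noncomputable def commonNbrs {V : Type*} [Fintype V] (G : SimpleGraph V) (u v : V) : Finset V := by
  classical exact {w | G.Adj u w ∧ G.Adj v w}

theorem mem_commonNbrs {V : Type*} [Fintype V] {G : SimpleGraph V} {u v w : V} :
    w ∈ commonNbrs G u v ↔ G.Adj u w ∧ G.Adj v w := by
  simp [commonNbrs]

/-- Each pair with a t-set of common neighbours spans a copy, and both lie inside its t + 2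
vertices. Bounding the fibres by all choices of two vertices and a subset avoids any discussion of
automorphisms of K_{2,t}. -/
theorem sum_choose_commonNbrs_le {n : ℕ} (t : ℕ) (G : SimpleGraph (Fin n)) :
    ∑ p ∈ (univ : Finset (Fin n)).offDiag, (#(commonNbrs G p.1 p.2)).choose t ≤
      (t + 2) ^ 2 * 2 ^ (t + 2) * numK2 t G := by
  classical
  let T : Finset (Σ _ : Fin n × Fin n, Finset (Fin n)) :=
    (univ : Finset (Fin n)).offDiag.sigma fun p => (commonNbrs G p.1 p.2).powersetCard t
  have hT : #T = ∑ p ∈ (univ : Finset (Fin n)).offDiag, (#(commonNbrs G p.1 p.2)).choose t := by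
    simp [T, Finset.card_sigma]
  rw [← hT]
  let Q : (Σ _ : Fin n × Fin n, Finset (Fin n)) → G.Subgraph → Prop := fun q H =>
    Nonempty (completeBipartiteGraph (Fin 2) (Fin t) ≃g H.coe) ∧
      H.verts = ({q.1.1, q.1.2} ∪ q.2 : Finset (Fin n))
  have hex : ∀ q ∈ T, ∃ H, Q q H := by
    rintro ⟨⟨x, y⟩, Z⟩ hq
    simp only [T, mem_sigma, mem_offDiag, mem_univ, true_and, mem_powersetCard] at hq
    obtain ⟨hxy, hZ, hc⟩ := hq
    let z := Z.equivFinOfCardEq hc |>.symm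
    have hz : ∀ j, G.Adj x (z j) ∧ G.Adj y (z j) := fun j => mem_commonNbrs.1 (hZ (z j).2)
    let v : Fin 2 ⊕ Fin t → Fin n := Sum.elim ![x, y] fun j => z j
    have hadj : ∀ i j, G.Adj (v (.inl i)) (v (.inr j)) := by
      intro i j
      fin_cases i
      · exact (hz j).1
      · exact (hz j).2
    have hv : Function.Injective v := by
      rintro (i | i) (j | j) h
      · fin_cases i <;> fin_cases j <;> simp [v] at h ⊢
        · exact hxy h
        · exact hxy h.symm
      · exact ((hadj i j).ne h).elim
      · exact ((hadj j i).ne h.symm).elim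
      · simp only [v, Sum.elim_inr] at h
        simpa using Subtype.ext h
    let f : (completeBipartiteGraph (Fin 2) (Fin t)).Copy G :=
      ⟨⟨v, fun {a b} hab => by
        rcases a with a | a <;> rcases b with b | b <;> simp at hab
        · exact hadj a b
        · exact (hadj b a).symm⟩, hv⟩
    refine ⟨f.toSubgraph, ⟨f.isoToSubgraph⟩, ?_⟩
    ext a
    simp only [SimpleGraph.Subgraph.map_verts, Set.mem_image, coe_union, coe_insert, coe_singleton,
      Set.mem_union, Set.mem_insert_iff, Set.mem_singleton_iff, mem_coe]
    constructor
    · rintro ⟨i | i, -, rfl⟩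
      · left
        fin_cases i
        · left; rfl
        · right; rfl
      · right; exact (z i).2
    · rintro ((rfl | rfl) | h)
      · exact ⟨.inl 0, by simp, rfl⟩
      · exact ⟨.inl 1, by simp, rfl⟩
      · exact ⟨.inr (z.symm ⟨a, h⟩), by simp, by simp [f, v]⟩
  choose! g hg using hex
  have hcard : ∀ H ∈ ({H : G.Subgraph |
      Nonempty (completeBipartiteGraph (Fin 2) (Fin t) ≃g H.coe)} : Finset G.Subgraph),
      #{q ∈ T | g q = H} ≤ (t + 2) ^ 2 * 2 ^ (t + 2) := by
    intro H hH
    simp only [mem_filter, mem_univ, true_and] at hH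
    obtain ⟨e⟩ := hH
    have hS : #H.verts.toFinset = t + 2 := by
      rw [Set.toFinset_card, ← Fintype.card_congr e.toEquiv]
      simp [add_comm]
    have : #((H.verts.toFinset ×ˢ H.verts.toFinset) ×ˢ H.verts.toFinset.powerset) =
        (t + 2) ^ 2 * 2 ^ (t + 2) := by
      rw [card_product, card_product, card_powerset, hS]; ring
    rw [← this]
    apply Finset.card_le_card_of_injOn (fun q => (q.1, q.2))
    · rintro q hq
      simp only [coe_filter, Set.mem_ofPred_eq] at hq
      have h2 := (hg q hq.1).2
      rw [hq.2] at h2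
      simp only [coe_product, Set.mem_prod, mem_coe, Set.mem_toFinset, mem_powerset, h2]
      refine ⟨⟨by simp, by simp⟩, ?_⟩
      intro a ha
      simp [ha]
    · rintro ⟨p, Z⟩ _ ⟨p', Z'⟩ _ h
      simp only [Prod.mk.injEq] at h
      rw [h.1, h.2]
  have := Finset.card_le_mul_card_image_of_maps_to (s := T) (f := g)
    (t := {H : G.Subgraph | Nonempty (completeBipartiteGraph (Fin 2) (Fin t) ≃g H.coe)})
    (fun q hq => by simpa using (hg q hq).1) _ hcard
  refine this.trans (le_of_eq ?_)
  rw [numK2, SimpleGraph.copyCount]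
  congr!

/-- Fix one edge of the clique: the other r - 2 vertices are common neighbours of its ends. -/
theorem numCliques_le_sum_choose {n : ℕ} {r : ℕ} (hr : 2 ≤ r) (G : SimpleGraph (Fin n))
    (P : Finset (Fin n × Fin n)) (hP : ∀ u v, G.Adj u v → (u, v) ∈ P) :
    numCliques r G ≤ ∑ p ∈ P, (#(commonNbrs G p.1 p.2)).choose (r - 2) := by
  classical
  rw [numCliques_eq_card]
  let T : Finset (Σ _ : Fin n × Fin n, Finset (Fin n)) :=
    P.sigma fun p => (commonNbrs G p.1 p.2).powersetCard (r - 2)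
  have hT : #T = ∑ p ∈ P, (#(commonNbrs G p.1 p.2)).choose (r - 2) := by
    simp [T, Finset.card_sigma]
  rw [← hT]
  apply Finset.card_le_card_of_surjOn (fun q => {q.1.1, q.1.2} ∪ q.2)
  intro R hR
  simp only [coe_filter, mem_univ, true_and, Set.mem_ofPred_eq] at hR
  obtain ⟨u, hu, v, hv, huv⟩ := Finset.one_lt_card.1 (by rw [hR.card_eq]; omega : 1 < #R)
  refine ⟨⟨(u, v), (R.erase u).erase v⟩, ?_, ?_⟩
  · simp only [T, coe_sigma, Set.mem_sigma_iff, mem_coe, mem_powersetCard]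
    refine ⟨hP _ _ (hR.isClique hu hv huv), ?_, ?_⟩
    · intro w hw
      simp only [mem_erase] at hw
      exact mem_commonNbrs.2 ⟨hR.isClique hu hw.2.2 (Ne.symm hw.2.1),
        hR.isClique hv hw.2.2 (Ne.symm hw.1)⟩
    · rw [card_erase_of_mem (mem_erase.2 ⟨huv.symm, hv⟩), card_erase_of_mem hu, hR.card_eq]
      omega
  · ext a
    simp only [mem_union, mem_insert, mem_singleton, mem_erase]
    by_cases h1 : a = u <;> by_cases h2 : a = v <;> simp_all

/-- Parametrisation of `denseBound`: with `w` the edge density and `ρ` the relative block size of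
the balanced configuration, all quantities become monomials. -/
theorem exists_density_params {t r n : ℕ} (ht : 2 ≤ t) (hr : 2 < r) (hn : 1 ≤ n) {k : ℝ}
    (hk : 0 < k) : ∃ w ρ : ℝ, 0 < w ∧ 0 < ρ ∧ ρ ^ t = w ^ (2 * t - 1) ∧
      k * (n : ℝ) ^ ((3 : ℝ) / 2) = w * ρ ^ (r - 2) * (n : ℝ) ^ r ∧
      denseBound t r n k = (n : ℝ) ^ (t + 2) * w ^ (2 * t) ∧
      (k * (n : ℝ) ^ ((3 : ℝ) / 2) ≤ (n : ℝ) ^ r → w ≤ 1) := by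
  have hn0 : (0 : ℝ) < n := by exact_mod_cast hn
  have htR : (2 : ℝ) ≤ t := by exact_mod_cast ht
  have hrR : (2 : ℝ) < r := by exact_mod_cast hr
  set E : ℝ := (2 * t - 1) * (r - 2) + t with hE
  have hE0 : 0 < E := by
    have : 0 < (2 * (t : ℝ) - 1) * (r - 2) := mul_pos (by linarith) (by linarith)
    linarith
  set X : ℝ := k * (n : ℝ) ^ ((3 : ℝ) / 2 - r) with hX
  have hX0 : 0 < X := by positivity
  have hXK : X * (n : ℝ) ^ r = k * (n : ℝ) ^ ((3 : ℝ) / 2) := by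
    rw [hX, mul_assoc, ← Real.rpow_natCast (n : ℝ) r, ← Real.rpow_add hn0]
    congr 2; ring
  -- X is the clique count divided by n^r; these exponents solve ρ^t = w^{2t-1} and w ρ^{r-2} = X.
  refine ⟨X ^ (t / E), X ^ ((2 * t - 1) / E), by positivity, by positivity, ?_, ?_, ?_, ?_⟩
  · rw [← Real.rpow_natCast, ← Real.rpow_natCast, ← Real.rpow_mul hX0.le, ← Real.rpow_mul hX0.le,
      Nat.cast_sub (by omega)]
    congr 1; push_cast; ring
  · rw [← hXK, ← Real.rpow_natCast _ (r - 2), ← Real.rpow_mul hX0.le, ← Real.rpow_add hX0,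
      Nat.cast_sub hr.le]
    congr 1
    conv_lhs => rw [← Real.rpow_one X]
    congr 1
    push_cast
    field_simp
    rw [hE]; ring
  · rw [denseBound, ← Real.rpow_natCast _ (2 * t), ← Real.rpow_mul hX0.le, hX,
      Real.mul_rpow hk.le (by positivity), ← Real.rpow_mul hn0.le, mul_left_comm,
      ← Real.rpow_natCast _ (t + 2), ← Real.rpow_add hn0, ← hE]
    congr 2
    · push_cast; ring
    · push_cast; field_simp; rw [hE]; ring
  · intro h
    apply Real.rpow_le_one hX0.le _ (by positivity)
    rw [← hXK] at h
    exact le_of_mul_le_mul_right (by linarith) (by positivity : (0 : ℝ) < (n : ℝ) ^ r)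

/-! ### Codegree thresholds and the lower bound. -/

theorem pow_le_mul_choose {x t : ℕ} (hx : t ≤ x) :
    (x : ℝ) ^ t ≤ (t ^ t * t.factorial : ℝ) * x.choose t := by
  have h1 : ((x + 1 - t : ℕ) ^ t : ℝ) / t.factorial ≤ x.choose t := Nat.pow_le_choose t x
  rw [div_le_iff₀ (by positivity)] at h1
  rcases Nat.eq_zero_or_pos t with rfl | ht
  · simp
  have h2 : x ≤ t * (x + 1 - t) := by
    obtain ⟨y, rfl⟩ := Nat.exists_eq_add_of_le hx
    rw [show t + y + 1 - t = y + 1 by omega]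
    nlinarith
  calc (x : ℝ) ^ t ≤ (t * (x + 1 - t : ℕ) : ℝ) ^ t := by
        gcongr; exact_mod_cast h2
    _ = t ^ t * ((x + 1 - t : ℕ) : ℝ) ^ t := mul_pow _ _ _
    _ ≤ t ^ t * (x.choose t * t.factorial) := by gcongr
    _ = _ := by ring

/-- Below L the first term suffices; above it x^s L^{t-s} ≤ x^t, which is comparable to C(x, t)
because x ≥ L ≥ t. Used with s = r - 2 for cliques and s = 1 for edges. -/
theorem choose_le_threshold {s t : ℕ} (hst : s ≤ t) (x : ℕ) {L : ℝ} (hL0 : 0 < L) (hL : t ≤ L) :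
    (x.choose s : ℝ) ≤ L ^ s + (t ^ t * t.factorial : ℝ) * x.choose t / L ^ (t - s) := by
  have h1 : (x.choose s : ℝ) ≤ (x : ℝ) ^ s := by exact_mod_cast Nat.choose_le_pow x s
  rcases le_total (x : ℝ) L with h | h
  · have : (x : ℝ) ^ s ≤ L ^ s := by gcongr
    have : 0 ≤ (t ^ t * t.factorial : ℝ) * x.choose t / L ^ (t - s) := by positivity
    linarith
  · have hx : t ≤ x := by exact_mod_cast hL.trans h
    have h2 : (x : ℝ) ^ s ≤ (t ^ t * t.factorial : ℝ) * x.choose t / L ^ (t - s) := by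
      rw [le_div_iff₀ (by positivity)]
      calc (x : ℝ) ^ s * L ^ (t - s) ≤ (x : ℝ) ^ s * (x : ℝ) ^ (t - s) := by gcongr
        _ = (x : ℝ) ^ t := by rw [← pow_add]; congr 1; omega
        _ ≤ _ := pow_le_mul_choose hx
    have : 0 ≤ L ^ s := by positivity
    linarith

/-- The ordered pairs of adjacent vertices. -/
noncomputable def adjPairs {n : ℕ} (G : SimpleGraph (Fin n)) : Finset (Fin n × Fin n) := by
  classical exact {p | G.Adj p.1 p.2}

/-- The number of pairs (ordered pair of vertices, `t`-set of common neighbours). -/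
noncomputable def cherrySum {n : ℕ} (t : ℕ) (G : SimpleGraph (Fin n)) : ℕ :=
  ∑ p ∈ (univ : Finset (Fin n)).offDiag, (#(commonNbrs G p.1 p.2)).choose t

theorem numCliques_le_threshold {n r t : ℕ} (hr : 2 ≤ r) (hrt : r ≤ 2 + t)
    (G : SimpleGraph (Fin n)) {L : ℝ} (hL0 : 0 < L) (hL : t ≤ L) :
    (numCliques r G : ℝ) ≤ #(adjPairs G) * L ^ (r - 2) +
      (t ^ t * t.factorial : ℝ) * cherrySum t G / L ^ (t - (r - 2)) := by
  have hsub : adjPairs G ⊆ (univ : Finset (Fin n)).offDiag := by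
    intro p hp
    simp only [adjPairs, mem_filter, mem_univ, true_and] at hp
    simpa using hp.ne
  have h1 := numCliques_le_sum_choose hr G (adjPairs G) (fun u v h => by simpa [adjPairs] using h)
  calc (numCliques r G : ℝ)
      ≤ ∑ p ∈ adjPairs G, ((#(commonNbrs G p.1 p.2)).choose (r - 2) : ℝ) := by exact_mod_cast h1
    _ ≤ ∑ p ∈ adjPairs G, (L ^ (r - 2) + (t ^ t * t.factorial : ℝ) / L ^ (t - (r - 2)) *
          (#(commonNbrs G p.1 p.2)).choose t) := by
        refine sum_le_sum fun p _ => (choose_le_threshold (by omega) _ hL0 hL).trans (le_of_eq ?_)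
        ring
    _ = #(adjPairs G) * L ^ (r - 2) + (t ^ t * t.factorial : ℝ) / L ^ (t - (r - 2)) *
          ∑ p ∈ adjPairs G, ((#(commonNbrs G p.1 p.2)).choose t : ℝ) := by
        rw [sum_add_distrib, ← mul_sum]; simp
    _ ≤ #(adjPairs G) * L ^ (r - 2) + (t ^ t * t.factorial : ℝ) / L ^ (t - (r - 2)) *
          cherrySum t G := by
        gcongr
        rw [cherrySum]
        exact_mod_cast sum_le_sum_of_subset hsub
    _ = _ := by ring

/-- Cauchy–Schwarz on the degrees: the codegrees over all ordered pairs sum to the squared degrees,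
and the diagonal pairs contribute the degrees themselves. -/
theorem sum_card_commonNbrs {n : ℕ} (G : SimpleGraph (Fin n)) :
    (#(adjPairs G)) ^ 2 ≤ n * (∑ p ∈ (univ : Finset (Fin n)).offDiag, #(commonNbrs G p.1 p.2) +
      #(adjPairs G)) := by
  classical
  let N : Fin n → Finset (Fin n) := fun u => {v | G.Adj u v}
  have hdeg : #(adjPairs G) = ∑ u, #(N u) := by
    rw [adjPairs, card_filter, ← univ_product_univ, sum_product]
    simp only [N, card_filter]
  have hdiag : ∑ p ∈ (univ : Finset (Fin n)).diag, #(commonNbrs G p.1 p.2) = #(adjPairs G) := by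
    rw [hdeg, sum_diag]
    refine sum_congr rfl fun u _ => ?_
    congr 1; ext v; simp [mem_commonNbrs, N]
  have hall : ∑ p : Fin n × Fin n, #(commonNbrs G p.1 p.2) = ∑ u, #(N u) ^ 2 := by
    have : ∀ p : Fin n × Fin n, #(commonNbrs G p.1 p.2) =
        ∑ w, (if G.Adj w p.1 then 1 else 0) * (if G.Adj w p.2 then 1 else 0) := by
      intro p
      rw [commonNbrs, card_filter]
      refine sum_congr rfl fun w _ => ?_
      by_cases h1 : G.Adj w p.1 <;> by_cases h2 : G.Adj w p.2 <;>
        simp [h1, h2, G.adj_comm p.1 w, G.adj_comm p.2 w]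
    simp_rw [this]
    rw [sum_comm]
    refine sum_congr rfl fun w _ => ?_
    rw [← univ_product_univ, sum_product]
    simp only [N, card_filter, sq, sum_mul_sum]
  have hsplit : ∑ p ∈ (univ : Finset (Fin n)).offDiag, #(commonNbrs G p.1 p.2) + #(adjPairs G) =
      ∑ u, #(N u) ^ 2 := by
    rw [← hdiag, ← hall, ← univ_product_univ, ← diag_union_offDiag,
      sum_union (disjoint_diag_offDiag _), add_comm]
  rw [hsplit, hdeg]
  have := sq_sum_le_card_mul_sum_sq (s := (univ : Finset (Fin n))) (f := fun u => #(N u))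
  simpa using this

theorem sq_adjPairs_le_threshold {n t : ℕ} (ht : 1 ≤ t) (G : SimpleGraph (Fin n)) {L : ℝ}
    (hL0 : 0 < L) (hL : t ≤ L) :
    (#(adjPairs G) : ℝ) ^ 2 ≤ n * (n ^ 2 * L +
      (t ^ t * t.factorial : ℝ) * cherrySum t G / L ^ (t - 1) + #(adjPairs G)) := by
  have h : (#(adjPairs G) : ℝ) ^ 2 ≤ n * (∑ p ∈ (univ : Finset (Fin n)).offDiag,
      (#(commonNbrs G p.1 p.2) : ℝ) + #(adjPairs G)) := by exact_mod_cast sum_card_commonNbrs G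
  refine h.trans ?_
  gcongr
  calc ∑ p ∈ (univ : Finset (Fin n)).offDiag, (#(commonNbrs G p.1 p.2) : ℝ)
      ≤ ∑ p ∈ (univ : Finset (Fin n)).offDiag, (L + (t ^ t * t.factorial : ℝ) / L ^ (t - 1) *
          (#(commonNbrs G p.1 p.2)).choose t) := by
        refine sum_le_sum fun p _ => ?_
        have := choose_le_threshold ht (#(commonNbrs G p.1 p.2)) hL0 hL
        rw [Nat.choose_one_right, pow_one] at this
        refine this.trans (le_of_eq ?_)
        ring
    _ = #((univ : Finset (Fin n)).offDiag) * L + (t ^ t * t.factorial : ℝ) / L ^ (t - 1) *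
          cherrySum t G := by
        rw [sum_add_distrib, ← mul_sum, cherrySum]; simp
    _ ≤ n ^ 2 * L + (t ^ t * t.factorial : ℝ) / L ^ (t - 1) * cherrySum t G := by
        gcongr
        have : #((univ : Finset (Fin n)).offDiag) ≤ n ^ 2 := by
          rw [offDiag_card, card_univ, Fintype.card_fin, sq]; omega
        exact_mod_cast this
    _ = _ := by ring

theorem rpow_three_halves_sq (n : ℕ) : ((n : ℝ) ^ ((3 : ℝ) / 2)) ^ 2 = (n : ℝ) ^ 3 := by
  rw [← Real.rpow_natCast, ← Real.rpow_mul (by positivity), ← Real.rpow_natCast]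
  norm_num

theorem le_rpow_three_halves {n : ℕ} (hn : 1 ≤ n) : (n : ℝ) ≤ (n : ℝ) ^ ((3 : ℝ) / 2) := by
  have hn0 : (1 : ℝ) ≤ n := by exact_mod_cast hn
  conv_lhs => rw [← Real.rpow_one (n : ℝ)]
  exact Real.rpow_le_rpow_of_exponent_le hn0 (by norm_num)

theorem rpow_one_div_pow {k : ℝ} (hk : 0 < k) {s : ℕ} (hs : 1 ≤ s) :
    (k ^ ((1 : ℝ) / s)) ^ s = k := by
  have hsR : (0 : ℝ) < s := by exact_mod_cast hs
  rw [← Real.rpow_natCast, ← Real.rpow_mul hk.le, one_div_mul_cancel hsR.ne', Real.rpow_one]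

theorem sparseBound_eq_pow (t s n : ℕ) {k : ℝ} (hk : 0 < k) :
    sparseBound t (s + 2) n k = (k ^ ((1 : ℝ) / s)) ^ t * (n : ℝ) ^ ((3 : ℝ) / 2) := by
  rw [sparseBound, ← Real.rpow_natCast, ← Real.rpow_mul hk.le, Nat.cast_add, Nat.cast_ofNat,
    add_sub_cancel_right, one_div_mul_eq_div]

theorem sparseBound_le_of_threshold {t s n : ℕ} (ht : 2 ≤ t) (hs1 : 1 ≤ s) (hst : s < t)
    {k e X : ℝ} (hk : (4 * t ^ 2) ^ t ≤ k)
    (h1 : ∀ L : ℝ, 0 < L → t ≤ L → k * (n : ℝ) ^ ((3 : ℝ) / 2) ≤ e * L ^ s + X / L ^ (t - s))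
    (hcase : e ≤ 2 * t * (n : ℝ) ^ ((3 : ℝ) / 2)) :
    sparseBound t (s + 2) n k ≤ 2 * (4 * t) ^ t * X := by
  have htR : (2 : ℝ) ≤ t := by exact_mod_cast ht
  have hk0 : 0 < k := lt_of_lt_of_le (by positivity) hk
  rw [sparseBound_eq_pow t s n hk0]
  set h : ℝ := (n : ℝ) ^ ((3 : ℝ) / 2)
  have hh : 0 ≤ h := by positivity
  set κ : ℝ := k ^ ((1 : ℝ) / s) with hκ
  have hκs : κ ^ s = k := rpow_one_div_pow hk0 hs1
  have hκ0 : 0 < κ := by positivity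
  have hκt : 4 * (t : ℝ) ^ 2 ≤ κ := by
    have h3 : (4 * (t : ℝ) ^ 2) ^ s ≤ κ ^ s := by
      rw [hκs]
      exact (pow_le_pow_right₀ (by nlinarith) hst.le).trans hk
    exact le_of_pow_le_pow_left₀ (by omega) hκ0.le h3
  -- At this level the edge term is at most half of the clique count; κ ≥ 4t², which comes from the
  -- lower bound on k, is what makes the level at least t.
  have hL := h1 (κ / (4 * t)) (by positivity) (by rw [le_div_iff₀ (by positivity)]; linarith)
  have h4 : e * (κ / (4 * t)) ^ s ≤ k * h / 2 := by
    rw [div_pow, hκs]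
    have : (4 * (t : ℝ)) ≤ (4 * (t : ℝ)) ^ s := le_self_pow₀ (by linarith) (by omega)
    calc e * (k / (4 * t) ^ s) ≤ (2 * t * h) * (k / (4 * t)) := by gcongr
      _ = k * h / 2 := by field_simp; ring
  have h5 : k * h / 2 ≤ X / (κ / (4 * t)) ^ (t - s) := by linarith
  rw [le_div_iff₀ (by positivity), div_pow] at h5
  have h6 : (4 * (t : ℝ)) ^ (t - s) ≤ (4 * t) ^ t :=
    pow_le_pow_right₀ (by linarith) (by omega)
  have h7 : κ ^ t = k * κ ^ (t - s) := by
    rw [← hκs, ← pow_add]; congr 1; omega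
  rw [h7]
  calc k * κ ^ (t - s) * h
      = 2 * (4 * t) ^ (t - s) * (k * h / 2 * (κ ^ (t - s) / (4 * t) ^ (t - s))) := by
        field_simp
    _ ≤ 2 * (4 * t) ^ t * X := by gcongr

theorem many_edges_of_threshold {t n : ℕ} (ht : 2 ≤ t) (hn : 1 ≤ n) {e X : ℝ}
    (h2 : ∀ L : ℝ, 0 < L → t ≤ L → e ^ 2 ≤ n * (n ^ 2 * L + X / L ^ (t - 1) + e))
    (hcase : 2 * t * (n : ℝ) ^ ((3 : ℝ) / 2) ≤ e) :
    (n : ℝ) ^ 2 * (e ^ 2 / (4 * n ^ 3)) ^ t ≤ X := by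
  have hn0 : (1 : ℝ) ≤ n := by exact_mod_cast hn
  have htR : (2 : ℝ) ≤ t := by exact_mod_cast ht
  have hh2 := rpow_three_halves_sq n
  have hhn := le_rpow_three_halves hn
  set h : ℝ := (n : ℝ) ^ ((3 : ℝ) / 2)
  have hh0 : 0 < h := by positivity
  have hee : 4 * (t : ℝ) ^ 2 * n ^ 3 ≤ e ^ 2 := by
    calc 4 * (t : ℝ) ^ 2 * n ^ 3 = (2 * t * h) ^ 2 := by rw [← hh2]; ring
      _ ≤ e ^ 2 := by gcongr
  have he0 : 0 < e := lt_of_lt_of_le (by positivity) hcase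
  have hLt : (t : ℝ) ≤ e ^ 2 / (4 * n ^ 3) := by
    rw [le_div_iff₀ (by positivity)]
    refine le_trans ?_ hee
    have : (t : ℝ) ≤ t ^ 2 := by nlinarith
    calc (t : ℝ) * (4 * n ^ 3) ≤ t ^ 2 * (4 * n ^ 3) := by gcongr
      _ = _ := by ring
  -- This level makes the low-codegree term exactly e²/4. The diagonal term is at most e²/2, so the
  -- pairs of high codegree must supply the remaining e²/4.
  have hL := h2 (e ^ 2 / (4 * n ^ 3)) (by positivity) hLt
  have h3 : (n : ℝ) * e ≤ e ^ 2 / 2 := by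
    have : 2 * (n : ℝ) ≤ e := by
      calc 2 * (n : ℝ) ≤ 2 * t * h := by
            have := mul_le_mul htR hhn (by positivity) (by positivity)
            linarith
        _ ≤ e := hcase
    nlinarith
  have h4 : (n : ℝ) * (n ^ 2 * (e ^ 2 / (4 * n ^ 3))) = e ^ 2 / 4 := by field_simp
  have h5 : e ^ 2 / (4 * n) ≤ X / (e ^ 2 / (4 * n ^ 3)) ^ (t - 1) := by
    rw [div_le_iff₀ (by positivity)]
    rw [mul_add, mul_add, h4] at hL
    linarith
  rw [le_div_iff₀ (by positivity)] at h5
  refine le_trans (le_of_eq ?_) h5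
  obtain ⟨u, rfl⟩ : ∃ u, t = u + 1 := ⟨t - 1, by omega⟩
  rw [Nat.add_sub_cancel, pow_succ' (e ^ 2 / (4 * (n : ℝ) ^ 3)), ← mul_assoc]
  congr 1
  field_simp

/-- In the dense range the relative block size `ρ` corresponds to at least one vertex. -/
theorem one_le_blockSize {t s n : ℕ} (ht : 2 ≤ t) (hn : 1 ≤ n) {k w ρ : ℝ}
    (hk : 1 ≤ k) (hw : 0 < w) (hρ : 0 < ρ) (hρw : ρ ^ t = w ^ (2 * t - 1))
    (hKρ : k * (n : ℝ) ^ ((3 : ℝ) / 2) = w * n ^ 2 * (ρ * n) ^ s) : 1 ≤ ρ * n := by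
  have hn0 : (1 : ℝ) ≤ n := by exact_mod_cast hn
  have hh2 := rpow_three_halves_sq n
  set h : ℝ := (n : ℝ) ^ ((3 : ℝ) / 2)
  have hh0 : 0 < h := by positivity
  -- If ρn < 1, then h ≤ w n² says w ≥ n^{-1/2}, while (ρn)^t < 1 says w^{2t-1} < n^{-t}; these
  -- conflict for n ≥ 1. The powers below are doubled to clear the half-integral exponent.
  by_contra! hlt
  have h3 : k * h ≤ w * n ^ 2 := by
    rw [hKρ]
    exact mul_le_of_le_one_right (by positivity) (pow_le_one₀ (by positivity) hlt.le)
  have h4 : h ≤ w * n ^ 2 := le_trans (by nlinarith) h3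
  have h5 : w ^ (2 * t - 1) * n ^ t < 1 := by
    rw [← hρw, ← mul_pow]
    exact pow_lt_one₀ (by positivity) hlt (by omega)
  have h6 : h ^ (2 * (2 * t - 1)) ≤ (w * n ^ 2) ^ (2 * (2 * t - 1)) := by gcongr
  have h7 : (w * (n : ℝ) ^ 2) ^ (2 * (2 * t - 1)) * n ^ (2 * t) =
      (w ^ (2 * t - 1) * n ^ t) ^ 2 * n ^ (4 * (2 * t - 1)) := by ring
  have h8 : (w ^ (2 * t - 1) * (n : ℝ) ^ t) ^ 2 < 1 := pow_lt_one₀ (by positivity) h5 (by omega)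
  rw [pow_mul, hh2, ← pow_mul] at h6
  have h9 : (n : ℝ) ^ (3 * (2 * t - 1)) * n ^ (2 * t) < n ^ (4 * (2 * t - 1)) := by
    calc (n : ℝ) ^ (3 * (2 * t - 1)) * n ^ (2 * t)
        ≤ (w * (n : ℝ) ^ 2) ^ (2 * (2 * t - 1)) * n ^ (2 * t) := by gcongr
      _ = _ := h7
      _ < 1 * n ^ (4 * (2 * t - 1)) := by gcongr
      _ = _ := one_mul _
  rw [← pow_add] at h9
  exact absurd h9 (not_lt.2 (pow_le_pow_right₀ hn0 (by omega)))

theorem denseBound_le_of_threshold {t s n : ℕ} (ht : 2 ≤ t) (hs1 : 1 ≤ s) (hst : s < t)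
    (hn : 1 ≤ n) {k e X : ℝ} (hk : 1 ≤ k) (he : 0 ≤ e) (hX : 0 ≤ X)
    (h1 : ∀ L : ℝ, 0 < L → t ≤ L → k * (n : ℝ) ^ ((3 : ℝ) / 2) ≤ e * L ^ s + X / L ^ (t - s))
    (h2 : (n : ℝ) ^ 2 * (e ^ 2 / (4 * n ^ 3)) ^ t ≤ X) :
    denseBound t (s + 2) n k ≤ (4 * (2 * t ^ t) ^ 2) ^ t * X ∨
      denseBound t (s + 2) n k ≤ 2 * (2 * t) ^ t * X := by
  have hn0 : (1 : ℝ) ≤ n := by exact_mod_cast hn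
  have htR : (2 : ℝ) ≤ t := by exact_mod_cast ht
  have hk0 : 0 < k := by linarith
  obtain ⟨w, ρ, hw, hρ, hρw, hK, hD, -⟩ :=
    exists_density_params (n := n) ht (by omega : 2 < s + 2) hn hk0
  rw [Nat.add_sub_cancel] at hK
  have hKρ : k * (n : ℝ) ^ ((3 : ℝ) / 2) = w * n ^ 2 * (ρ * n) ^ s := by rw [hK]; ring
  have hρn : 1 ≤ ρ * n := one_le_blockSize ht hn hk hw hρ hρw hKρ
  set K : ℝ := k * (n : ℝ) ^ ((3 : ℝ) / 2)
  have hK0 : 0 < K := by positivity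
  have hwρ : w * ρ ^ t = w ^ (2 * t) := by
    rw [hρw, ← pow_succ']; congr 1; omega
  have hDρ : denseBound t (s + 2) n k = K * (ρ * n) ^ (t - s) := by
    rw [hD, ← hwρ, hKρ, mul_assoc _ ((ρ * n) ^ s), ← pow_add, show s + (t - s) = t by omega]
    ring
  -- With about w n² edges or more, the Cauchy–Schwarz bound already gives D. With fewer, the edge
  -- term of the clique bound is negligible; the factor 2 t^t leaves room for the level L = t below.
  rcases le_total (w * n ^ 2) (e * (2 * t ^ t)) with hew | hew
  · left
    have h7 : w ^ 2 * n ≤ (4 * (2 * (t : ℝ) ^ t) ^ 2) * (e ^ 2 / (4 * n ^ 3)) := by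
      have : (w * n ^ 2) ^ 2 ≤ (e * (2 * t ^ t)) ^ 2 := by gcongr
      rw [← mul_div_assoc, le_div_iff₀ (by positivity)]
      calc w ^ 2 * n * (4 * n ^ 3) = 4 * (w * n ^ 2) ^ 2 := by ring
        _ ≤ 4 * (e * (2 * t ^ t)) ^ 2 := by gcongr
        _ = _ := by ring
    rw [hD]
    calc (n : ℝ) ^ (t + 2) * w ^ (2 * t) = n ^ 2 * (w ^ 2 * n) ^ t := by ring
      _ ≤ n ^ 2 * ((4 * (2 * (t : ℝ) ^ t) ^ 2) * (e ^ 2 / (4 * n ^ 3))) ^ t := by gcongr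
      _ = (4 * (2 * (t : ℝ) ^ t) ^ 2) ^ t * (n ^ 2 * (e ^ 2 / (4 * n ^ 3)) ^ t) := by
        rw [mul_pow (4 * (2 * (t : ℝ) ^ t) ^ 2)]; ring
      _ ≤ _ := by gcongr
  · right
    have hts : (t : ℝ) ^ s ≤ t ^ t := pow_le_pow_right₀ (by linarith) hst.le
    rw [hDρ]
    -- The natural level is ρn/2, but it must be at least t. When ρn < 2t, the level t does as well,
    -- since then ρn lies between 1 and 2t.
    rcases le_total (2 * (t : ℝ)) (ρ * n) with hd | hd
    · have hL := h1 (ρ * n / 2) (by positivity) (by linarith)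
      have h3 : e * (ρ * n / 2) ^ s ≤ K / 2 := by
        have h4 : (2 : ℝ) ≤ 2 ^ s := le_self_pow₀ (by norm_num) (by omega)
        have h5 : e ≤ w * n ^ 2 := by
          refine le_trans ?_ hew
          have htt : (1 : ℝ) ≤ t ^ t := one_le_pow₀ (by linarith)
          exact le_mul_of_one_le_right he (by linarith)
        rw [hKρ, div_pow]
        calc e * ((ρ * n) ^ s / 2 ^ s) ≤ w * n ^ 2 * ((ρ * n) ^ s / 2) := by gcongr
          _ = _ := by ring
      have h5 : K / 2 ≤ X / (ρ * n / 2) ^ (t - s) := by linarith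
      rw [le_div_iff₀ (by positivity), div_pow] at h5
      have h6 : (2 : ℝ) ^ (t - s) ≤ (2 * t) ^ t :=
        (pow_le_pow_left₀ (by norm_num) (by linarith) _).trans
          (pow_le_pow_right₀ (by linarith) (by omega))
      calc K * (ρ * n) ^ (t - s)
          = 2 * 2 ^ (t - s) * (K / 2 * ((ρ * n) ^ (t - s) / 2 ^ (t - s))) := by field_simp
        _ ≤ 2 * (2 * t) ^ t * X := by gcongr
    · have hL := h1 t (by linarith) le_rfl
      have h3 : e * t ^ s ≤ K / 2 := by
        have h5 : w * n ^ 2 ≤ K := by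
          rw [hKρ]
          exact le_mul_of_one_le_right (by positivity) (one_le_pow₀ hρn)
        have : e * t ^ s ≤ e * t ^ t := by gcongr
        linarith
      have h5 : K / 2 ≤ X := by
        have : X / (t : ℝ) ^ (t - s) ≤ X := div_le_self hX (one_le_pow₀ (by linarith))
        linarith
      have h6 : (ρ * n) ^ (t - s) ≤ (2 * (t : ℝ)) ^ t :=
        (pow_le_pow_left₀ (by positivity) hd _).trans
          (pow_le_pow_right₀ (by linarith) (by omega))
      calc K * (ρ * n) ^ (t - s) ≤ (2 * X) * (2 * t) ^ t := by
            gcongr; linarith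
        _ = _ := by ring

theorem exists_lower_bound (t : ℕ) (ht : 2 ≤ t) : ∃ c : ℝ, 0 < c ∧ ∀ r : ℕ, 2 < r → r < 2 + t →
    ∀ (n : ℕ) (G : SimpleGraph (Fin n)) (k : ℝ), (4 * t ^ 2) ^ t ≤ k →
      (numCliques r G : ℝ) = k * (n : ℝ) ^ ((3 : ℝ) / 2) →
      c * min (sparseBound t r n k) (denseBound t r n k) ≤ (numK2 t G : ℝ) := by
  set a : ℝ := t ^ t * t.factorial with ha
  have htR : (2 : ℝ) ≤ t := by exact_mod_cast ht
  have ha0 : 0 < a := by positivity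
  set d : ℝ := (t + 2) ^ 2 * 2 ^ (t + 2) with hd
  have hd0 : 0 < d := by positivity
  set c₁ : ℝ := 2 * (4 * t) ^ t
  set c₂ : ℝ := (4 * (2 * t ^ t) ^ 2) ^ t
  set c₃ : ℝ := 2 * (2 * t) ^ t
  have hc₁ : 0 < c₁ := by positivity
  have hc₂ : 0 < c₂ := by positivity
  have hc₃ : 0 < c₃ := by positivity
  refine ⟨1 / ((c₁ + c₂ + c₃) * a * d), by positivity, fun r hr hrt n G k hk hK => ?_⟩
  rw [one_div_mul_eq_div, div_le_iff₀ (by positivity)]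
  rcases Nat.eq_zero_or_pos n with rfl | hn
  · apply (min_le_left _ _).trans
    rw [sparseBound, Nat.cast_zero, Real.zero_rpow (by norm_num), mul_zero]
    positivity
  obtain ⟨s, rfl⟩ : ∃ s, r = s + 2 := ⟨r - 2, by omega⟩
  have h1 : ∀ L : ℝ, 0 < L → t ≤ L → k * (n : ℝ) ^ ((3 : ℝ) / 2) ≤
      #(adjPairs G) * L ^ s + a * cherrySum t G / L ^ (t - s) :=
    fun L hL0 hL => hK ▸ numCliques_le_threshold hr.le hrt.le G hL0 hL
  set X : ℝ := a * cherrySum t G with hX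
  have hX0 : 0 ≤ X := by positivity
  have hk1 : 1 ≤ k := le_trans (one_le_pow₀ (by nlinarith)) hk
  have key : min (sparseBound t (s + 2) n k) (denseBound t (s + 2) n k) ≤ (c₁ + c₂ + c₃) * X := by
    have e1 : 0 ≤ c₁ * X := by positivity
    have e2 : 0 ≤ c₂ * X := by positivity
    have e3 : 0 ≤ c₃ * X := by positivity
    rw [add_mul, add_mul]
    rcases le_total (#(adjPairs G) : ℝ) (2 * t * (n : ℝ) ^ ((3 : ℝ) / 2)) with hc | hc
    · refine (min_le_left _ _).trans
        ((sparseBound_le_of_threshold ht (by omega) (by omega) hk h1 hc).trans ?_)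
      linarith
    · have h2 := many_edges_of_threshold ht hn
        (fun L hL0 hL => sq_adjPairs_le_threshold (by omega) G hL0 hL) hc
      refine (min_le_right _ _).trans ?_
      rcases denseBound_le_of_threshold ht (by omega) (by omega) hn hk1 (by positivity) hX0 h1 h2
        with h | h
      · linarith
      · linarith
  have h2 : (cherrySum t G : ℝ) ≤ d * numK2 t G := by
    rw [hd]; exact_mod_cast sum_choose_commonNbrs_le t G
  calc _ ≤ (c₁ + c₂ + c₃) * X := key
    _ ≤ (c₁ + c₂ + c₃) * (a * (d * numK2 t G)) := by rw [hX]; gcongr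
    _ = _ := by ring

/-! ### Block graphs: cliques and patterns. -/

/-- The graph on `V` which is the union of the cliques on the blocks
`{φ (a, F (j, a)) | a}`, for `j ∈ J`. -/
def blockGraph {V : Type*} {d M N : ℕ} (φ : Fin d × Fin M ↪ V) (F : Fin N × Fin d → Fin M)
    (J : Finset (Fin N)) : SimpleGraph V where
  Adj u v := u ≠ v ∧ ∃ j ∈ J, (∃ a, φ (a, F (j, a)) = u) ∧ ∃ b, φ (b, F (j, b)) = v
  symm := ⟨fun _ _ ⟨h, j, hj, hu, hv⟩ => ⟨h.symm, j, hj, hv, hu⟩⟩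
  loopless := ⟨fun _ h => h.1 rfl⟩

/-- A potential copy of `K_{2,t}` in a block graph: the vertices, and a block for each edge. -/
abbrev Pattern (d M N t : ℕ) := (Fin 2 ⊕ Fin t → Fin d × Fin M) × (Fin 2 × Fin t → Fin N)

/-- The incidences between blocks and vertices in a pattern. -/
def incidences {N t : ℕ} (j : Fin 2 × Fin t → Fin N) : Finset (Fin N × (Fin 2 ⊕ Fin t)) :=
  (univ.image fun e => (j e, .inl e.1)) ∪ univ.image fun e => (j e, .inr e.2)

/-- The pattern `p` is realised by `F`. -/
def Realises {d M N t : ℕ} (F : Fin N × Fin d → Fin M) (p : Pattern d M N t) : Prop :=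
  Function.Injective p.1 ∧ ∀ x ∈ incidences p.2, F (x.1, (p.1 x.2).1) = (p.1 x.2).2

open Classical in
/-- The patterns realised by `F`. -/
noncomputable def patterns {d M N : ℕ} (t : ℕ) (F : Fin N × Fin d → Fin M) :
    Finset (Pattern d M N t) :=
  {p | Realises F p}

theorem mem_patterns {d M N t : ℕ} {F : Fin N × Fin d → Fin M} {p : Pattern d M N t} :
    p ∈ patterns t F ↔ Realises F p := by
  simp [patterns]

/-- Pairs of blocks agreeing on the coordinates in `A`. -/
def coincidences {d M N : ℕ} (F : Fin N × Fin d → Fin M) (A : Finset (Fin d)) :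
    Finset (Fin N × Fin N) :=
  {p | p.1 < p.2 ∧ ∀ a ∈ A, F (p.1, a) = F (p.2, a)}

/-- Choose a block for every edge and read each vertex's coordinates off one incident edge; since
`φ` is injective, the other incident edges give the same coordinates. -/
theorem exists_pattern_of_isLabelledK2 {V : Type*} {d M N t : ℕ} (ht : 1 ≤ t)
    {φ : Fin d × Fin M ↪ V} {F : Fin N × Fin d → Fin M} {J : Finset (Fin N)}
    {v : Fin 2 ⊕ Fin t → V} (hv : IsLabelledK2 (blockGraph φ F J) v) :
    ∃ p ∈ patterns t F, (∀ e, p.2 e ∈ J) ∧ (fun x => φ (p.1 x)) = v := by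
  have h1 : ∀ e : Fin 2 × Fin t, ∃ j a b, j ∈ J ∧ φ (a, F (j, a)) = v (.inl e.1) ∧
      φ (b, F (j, b)) = v (.inr e.2) := fun e => by
    obtain ⟨-, j, hj, ⟨a, ha⟩, b, hb⟩ := hv.2 e.1 e.2
    exact ⟨j, a, b, hj, ha, hb⟩
  choose j a b hj ha hb using h1
  let v' : Fin 2 ⊕ Fin t → Fin d × Fin M := Sum.elim
    (fun i => (a (i, ⟨0, ht⟩), F (j (i, ⟨0, ht⟩), a (i, ⟨0, ht⟩))))
    (fun z => (b (0, z), F (j (0, z), b (0, z))))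
  have hv' : (fun x => φ (v' x)) = v := by
    funext x
    rcases x with i | z
    · exact ha (i, ⟨0, ht⟩)
    · exact hb (0, z)
  refine ⟨(v', j), ?_, hj, hv'⟩
  rw [mem_patterns]
  refine ⟨?_, ?_⟩
  · intro x y hxy
    apply hv.1
    rw [← hv']
    exact congrArg φ hxy
  · intro x hx
    simp only [incidences, mem_union, mem_image, mem_univ, true_and] at hx
    rcases hx with ⟨e, rfl⟩ | ⟨e, rfl⟩
    · have : v' (.inl e.1) = (a e, F (j e, a e)) := φ.injective (by
        rw [ha e]; exact congrFun hv' (.inl e.1))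
      simp only [this]
    · have : v' (.inr e.2) = (b e, F (j e, b e)) := φ.injective (by
        rw [hb e]; exact congrFun hv' (.inr e.2))
      simp only [this]

theorem numK2_blockGraph_le {n d M N t : ℕ} (ht : 1 ≤ t)
    (φ : Fin d × Fin M ↪ Fin n) (F : Fin N × Fin d → Fin M) (J : Finset (Fin N)) :
    numK2 t (blockGraph φ F J) ≤ #{p ∈ patterns t F | ∀ e, p.2 e ∈ J} := by
  classical
  refine (numK2_le_card t _).trans ?_
  apply Finset.card_le_card_of_surjOn (fun p x => φ (p.1 x))
  intro v hv
  simp only [coe_filter, mem_univ, true_and, Set.mem_ofPred_eq] at hv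
  obtain ⟨p, hp, hJ, rfl⟩ := exists_pattern_of_isLabelledK2 ht hv
  exact ⟨p, mem_coe.2 (mem_filter.2 ⟨hp, hJ⟩), rfl⟩

theorem card_le_card_image_add {ι β : Type*} [LinearOrder ι] [Fintype ι] [DecidableEq β]
    (J : Finset ι) (f : ι → β) :
    #J ≤ #(J.image f) + #{p : ι × ι | p.1 < p.2 ∧ f p.1 = f p.2} := by
  set B : Finset ι := {j ∈ J | ∃ i ∈ J, i < j ∧ f i = f j} with hB
  have h1 : #(J \ B) ≤ #(J.image f) := by
    apply Finset.card_le_card_of_injOn f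
    · intro x hx
      simp only [coe_sdiff, Set.mem_sdiff, mem_coe] at hx
      simpa using ⟨x, hx.1, rfl⟩
    · intro x hx y hy hxy
      simp only [coe_sdiff, Set.mem_sdiff, mem_coe, hB, mem_filter, not_and, not_exists] at hx hy
      rcases lt_trichotomy x y with h | h | h
      · exact (hy.2 hy.1 x hx.1 h hxy).elim
      · exact h
      · exact (hx.2 hx.1 y hy.1 h hxy.symm).elim
  have h2 : #B ≤ #{p : ι × ι | p.1 < p.2 ∧ f p.1 = f p.2} := by
    apply Finset.card_le_card_of_surjOn Prod.snd
    intro j hj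
    simp only [hB, coe_filter, Set.mem_ofPred_eq] at hj
    obtain ⟨-, i, -, hij, hf⟩ := hj
    exact ⟨(i, j), by simpa using ⟨hij, hf⟩, rfl⟩
  have h3 : #J ≤ #(J \ B) + #B := by
    have := le_card_sdiff B J
    omega
  omega

/-- A clique taken from a block remembers its set A of classes, so different A give different
cliques. For fixed A, a clique is lost only when two blocks agree on A. -/
theorem le_numCliques_blockGraph {n d M N r : ℕ} (φ : Fin d × Fin M ↪ Fin n)
    (F : Fin N × Fin d → Fin M) (J : Finset (Fin N)) :
    d.choose r * #J ≤ numCliques r (blockGraph φ F J) +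
      ∑ A ∈ powersetCard r (univ : Finset (Fin d)), #(coincidences F A) := by
  classical
  let R : Finset (Fin d) → Fin N → Finset (Fin n) := fun A j => A.image fun a => φ (a, F (j, a))
  have hinj : ∀ j, Function.Injective fun a : Fin d => φ (a, F (j, a)) := fun j a b h => by
    have := φ.injective h
    simpa using congrArg Prod.fst this
  have hR : ∀ A A' j j', R A j = R A' j' → A ⊆ A' ∧ ∀ a ∈ A, F (j, a) = F (j', a) := by
    intro A A' j j' h
    have : ∀ a ∈ A, a ∈ A' ∧ F (j, a) = F (j', a) := by
      intro a ha
      have h1 : φ (a, F (j, a)) ∈ R A' j' := h ▸ mem_image_of_mem _ ha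
      simp only [R, mem_image, EmbeddingLike.apply_eq_iff_eq, Prod.mk.injEq] at h1
      obtain ⟨b, hb, rfl, hF⟩ := h1
      exact ⟨hb, hF.symm⟩
    exact ⟨fun a ha => (this a ha).1, fun a ha => (this a ha).2⟩
  have hcl : #((powersetCard r (univ : Finset (Fin d))).biUnion fun A => J.image (R A)) ≤
      numCliques r (blockGraph φ F J) := by
    rw [numCliques_eq_card]
    apply card_le_card
    intro S hS
    simp only [mem_biUnion, mem_powersetCard, mem_image] at hS
    obtain ⟨A, ⟨-, hA⟩, j, hj, rfl⟩ := hS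
    simp only [mem_filter, mem_univ, true_and]
    constructor
    · intro u hu v hv huv
      simp only [R, coe_image, Set.mem_image, mem_coe] at hu hv
      obtain ⟨a, -, rfl⟩ := hu
      obtain ⟨b, -, rfl⟩ := hv
      exact ⟨huv, j, hj, ⟨a, rfl⟩, ⟨b, rfl⟩⟩
    · rw [card_image_of_injective _ (hinj j), hA]
  rw [card_biUnion] at hcl
  · refine le_trans ?_ (Nat.add_le_add_right hcl _)
    rw [← sum_add_distrib]
    have hN : d.choose r = #(powersetCard r (univ : Finset (Fin d))) := by simp
    rw [hN, ← smul_eq_mul]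
    apply card_nsmul_le_sum
    intro A _
    refine (card_le_card_image_add J (R A)).trans ?_
    gcongr
    intro p hp
    simp only [mem_filter, mem_univ, true_and, coincidences] at hp ⊢
    exact ⟨hp.1, (hR _ _ _ _ hp.2).2⟩
  · intro A hA A' hA' hne
    rw [Function.onFun, disjoint_left]
    intro S hS hS'
    simp only [mem_image] at hS hS'
    obtain ⟨j, -, rfl⟩ := hS
    obtain ⟨j', -, h⟩ := hS'
    exact hne (subset_antisymm (hR _ _ _ _ h.symm).1 (hR _ _ _ _ h).1)

/-! ### First-moment estimates over random blocks. -/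

theorem card_filter_prescribed {ι : Type*} [Fintype ι] [DecidableEq ι] {M : ℕ} (I : Finset ι)
    (g : ι → Fin M) :
    #{F : ι → Fin M | ∀ x ∈ I, F x = g x} * M ^ #I = M ^ Fintype.card ι := by
  have h : ({F : ι → Fin M | ∀ x ∈ I, F x = g x} : Finset (ι → Fin M)) =
      Fintype.piFinset fun x => if x ∈ I then {g x} else univ := by
    ext F
    simp only [mem_filter, mem_univ, true_and, Fintype.mem_piFinset]
    refine forall_congr' fun x => ?_
    by_cases hx : x ∈ I <;> simp [hx]
  have h2 : ∀ x, #(if x ∈ I then ({g x} : Finset (Fin M)) else univ) = if x ∈ I then 1 else M := by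
    intro x
    split_ifs <;> simp
  rw [h, Fintype.card_piFinset]
  simp_rw [h2]
  rw [prod_ite, prod_const_one, one_mul, prod_const, ← pow_add, filter_not, filter_mem_eq_inter,
    univ_inter, card_univ_sdiff, Nat.sub_add_cancel (card_le_univ I)]

/-- A block meets each class once, so distinct vertices of a block lie in distinct classes. Hence
the incidences prescribe `F` at distinct places, and the realisation probability is at most M to the
minus their number. -/
theorem Realises.injOn {d M N t : ℕ} {F : Fin N × Fin d → Fin M} {p : Pattern d M N t}
    (h : Realises F p) :
    Set.InjOn (fun x : Fin N × (Fin 2 ⊕ Fin t) => (x.1, (p.1 x.2).1)) (incidences p.2) := by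
  rintro ⟨b, q⟩ hx ⟨b', q'⟩ hy hxy
  simp only [Prod.mk.injEq] at hxy
  obtain ⟨rfl, hq⟩ := hxy
  have h1 := h.2 _ hx
  have h2 := h.2 _ hy
  simp only at h1 h2
  rw [hq, h2] at h1
  exact Prod.ext rfl (h.1 (Prod.ext hq h1.symm))

open Classical in
theorem card_realises_mul_le {d M N t : ℕ} (p : Pattern d M N t) :
    #{F : Fin N × Fin d → Fin M | Realises F p} * M ^ #(incidences p.2) ≤ M ^ (N * d) := by
  rcases Finset.eq_empty_or_nonempty {F : Fin N × Fin d → Fin M | Realises F p} with h | ⟨F₀, hF₀⟩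
  · simp [h]
  replace hF₀ := (mem_filter.1 hF₀).2
  set I : Finset (Fin N × Fin d) :=
    (incidences p.2).image fun x : Fin N × (Fin 2 ⊕ Fin t) => (x.1, (p.1 x.2).1) with hI
  have hcard : #I = #(incidences p.2) := card_image_of_injOn hF₀.injOn
  have := card_filter_prescribed I F₀
  rw [Fintype.card_prod, Fintype.card_fin, Fintype.card_fin, hcard] at this
  rw [← this]
  gcongr
  intro hF x hx
  simp only [hI, mem_image] at hx
  obtain ⟨y, hy, rfl⟩ := hx
  rw [hF.2 y hy, hF₀.2 y hy]

/-- A single block carrying every edge would contain t + 2 vertices in distinct classes, but there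
are only d classes. -/
theorem Realises.two_le_card_image {d M N t : ℕ} (ht : 1 ≤ t) (hd : d < t + 2)
    {F : Fin N × Fin d → Fin M} {p : Pattern d M N t} (h : Realises F p) :
    2 ≤ #(univ.image p.2) := by
  by_contra! hlt
  have hc : ∀ e e', p.2 e = p.2 e' := fun e e' =>
    card_le_one.1 (by omega : #(univ.image p.2) ≤ 1) _ (mem_image_of_mem _ (mem_univ _)) _
      (mem_image_of_mem _ (mem_univ _))
  set b := p.2 (0, ⟨0, ht⟩) with hb
  have hmem : ∀ q, (b, q) ∈ incidences p.2 := by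
    intro q
    simp only [incidences, mem_union, mem_image, mem_univ, true_and]
    rcases q with i | z
    · exact .inl ⟨(i, ⟨0, ht⟩), Prod.ext (hc _ _) rfl⟩
    · exact .inr ⟨(0, z), Prod.ext (hc _ _) rfl⟩
  have hinj : Function.Injective fun q => (p.1 q).1 := by
    intro q q' hq
    have := h.injOn (hmem q) (hmem q') (Prod.ext rfl hq)
    exact congrArg Prod.snd this
  have := Fintype.card_le_of_injective _ hinj
  simp at this
  omega

theorem sum_card_le_card_incidences {N t : ℕ} (j : Fin 2 × Fin t → Fin N) :
    ∑ b ∈ univ.image j, (#(({e | j e = b} : Finset (Fin 2 × Fin t)).image Prod.fst) +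
      #(({e | j e = b} : Finset (Fin 2 × Fin t)).image Prod.snd)) ≤ #(incidences j) := by
  rw [card_eq_sum_card_fiberwise (f := Prod.fst) (t := univ.image j)]
  · refine sum_le_sum fun b _ => ?_
    rw [← card_disjSum]
    apply card_le_card_of_injOn (fun q => (b, q))
    · intro q hq
      simp only [coe_filter, Set.mem_ofPred_eq, incidences, mem_union, mem_image, mem_univ,
        true_and, and_true]
      rcases q with i | z
      · simp only [mem_coe, inl_mem_disjSum, mem_image, mem_filter, mem_univ, true_and] at hq
        obtain ⟨e, he, rfl⟩ := hq
        exact .inl ⟨e, by rw [he]⟩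
      · simp only [mem_coe, inr_mem_disjSum, mem_image, mem_filter, mem_univ, true_and] at hq
        obtain ⟨e, he, rfl⟩ := hq
        exact .inr ⟨e, by rw [he]⟩
    · intro q _ q' _ h
      exact congrArg Prod.snd h
  · intro x hx
    simp only [mem_coe, incidences, mem_union, mem_image, mem_univ, true_and] at hx ⊢
    rcases hx with ⟨e, rfl⟩ | ⟨e, rfl⟩ <;> exact ⟨e, rfl⟩

/-- The weight of a single block in a pattern is at most that of its edges taken separately. -/
theorem block_weight_le {t : ℕ} {w ρ : ℝ} (hw : 0 < w) (hw1 : w ≤ 1) (hρ : 0 < ρ)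
    (hρw : ρ ^ t ≤ w ^ (2 * t - 1)) {S : Finset (Fin 2 × Fin t)} (hS : S.Nonempty) :
    w * ρ ^ (#(S.image Prod.fst) + #(S.image Prod.snd)) ≤ ρ ^ 2 * w ^ #S := by
  have ht : 1 ≤ t := by
    obtain ⟨⟨_, z⟩, _⟩ := hS
    exact z.pos
  have hcard : #S ≤ #(S.image Prod.fst) * #(S.image Prod.snd) := by
    rw [← card_product]
    exact card_le_card subset_product
  have h1 : 1 ≤ #(S.image Prod.fst) := (hS.image _).card_pos
  have h2 : #(S.image Prod.fst) ≤ 2 := by simpa using card_le_univ (S.image Prod.fst)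
  have h3 : 1 ≤ #(S.image Prod.snd) := (hS.image _).card_pos
  have h4 : #(S.image Prod.snd) ≤ t := by simpa using card_le_univ (S.image Prod.snd)
  set q := #(S.image Prod.snd)
  obtain hp | hp : #(S.image Prod.fst) = 1 ∨ #(S.image Prod.fst) = 2 := by omega
  · rw [hp] at hcard ⊢
    rw [one_mul] at hcard
    have hρw' : ρ ≤ w := by
      refine le_of_pow_le_pow_left₀ (n := t) (by omega) hw.le (hρw.trans ?_)
      exact pow_le_pow_of_le_one hw.le hw1 (by omega)
    calc w * ρ ^ (1 + q) = ρ ^ 2 * (w * ρ ^ (q - 1)) := by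
          rw [mul_left_comm, ← pow_add]; congr 2; omega
      _ ≤ ρ ^ 2 * (w * w ^ (q - 1)) := by gcongr
      _ = ρ ^ 2 * w ^ q := by rw [← pow_succ']; congr 2; omega
      _ ≤ ρ ^ 2 * w ^ #S := by
        gcongr 1
        exact pow_le_pow_of_le_one hw.le hw1 hcard
  · rw [hp] at hcard ⊢
    -- After taking t-th powers this is 2qt ≤ t + (2t - 1)q, that is q ≤ t. For a block holding all
    -- of K_{2,t} it is tight, which is why ρ^t = w^{2t-1} is the right balance.
    have key : w * ρ ^ q ≤ w ^ (2 * q) := by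
      refine le_of_pow_le_pow_left₀ (n := t) (by omega) (by positivity) ?_
      calc (w * ρ ^ q) ^ t = w ^ t * (ρ ^ t) ^ q := by ring
        _ ≤ w ^ t * (w ^ (2 * t - 1)) ^ q := by gcongr
        _ = w ^ (t + (2 * t - 1) * q) := by rw [pow_add, pow_mul]
        _ ≤ w ^ (2 * q * t) := by
          apply pow_le_pow_of_le_one hw.le hw1
          obtain ⟨u, rfl⟩ : ∃ u, t = u + 1 := ⟨t - 1, by omega⟩
          rw [show 2 * (u + 1) - 1 = 2 * u + 1 by omega]
          nlinarith
        _ = _ := pow_mul _ _ _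
    calc w * ρ ^ (2 + q) = ρ ^ 2 * (w * ρ ^ q) := by ring
      _ ≤ ρ ^ 2 * w ^ (2 * q) := by gcongr
      _ ≤ ρ ^ 2 * w ^ #S := by
        gcongr 1
        exact pow_le_pow_of_le_one hw.le hw1 hcard

/-- The left side factors over the blocks used: a block carrying the edge set S contributes at most
θ w^{|S|}, and the sets S partition the 2t edges. -/
theorem incidence_weight_le {N t : ℕ} {w ρ θ : ℝ} (hw : 0 < w) (hw1 : w ≤ 1) (hρ : 0 < ρ)
    (hρ1 : ρ ≤ 1) (hρw : ρ ^ t ≤ w ^ (2 * t - 1)) (hN : N * ρ ^ 2 ≤ θ * w)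
    (j : Fin 2 × Fin t → Fin N) :
    ρ ^ #(incidences j) * N ^ #(univ.image j) ≤ θ ^ #(univ.image j) * w ^ (2 * t) := by
  have h2t : 2 * t = ∑ b ∈ univ.image j, #({e | j e = b} : Finset (Fin 2 × Fin t)) := by
    rw [← card_eq_sum_card_image]; simp
  rw [h2t, ← prod_pow_eq_pow_sum, ← prod_const (N : ℝ), ← prod_const θ, ← prod_mul_distrib]
  calc ρ ^ #(incidences j) * ∏ _b ∈ univ.image j, (N : ℝ)
      ≤ ρ ^ (∑ b ∈ univ.image j, (#(({e | j e = b} : Finset (Fin 2 × Fin t)).image Prod.fst) +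
          #(({e | j e = b} : Finset (Fin 2 × Fin t)).image Prod.snd))) *
          ∏ _b ∈ univ.image j, (N : ℝ) := by
        gcongr 1
        exact pow_le_pow_of_le_one hρ.le hρ1 (sum_card_le_card_incidences j)
    _ = ∏ b ∈ univ.image j, (ρ ^ (#(({e | j e = b} : Finset (Fin 2 × Fin t)).image Prod.fst) +
          #(({e | j e = b} : Finset (Fin 2 × Fin t)).image Prod.snd)) * N) := by
        rw [prod_mul_distrib, prod_pow_eq_pow_sum]
    _ ≤ _ := by
        apply prod_le_prod
        · intros; positivity
        · intro b hb
          obtain ⟨e, -, he⟩ := mem_image.1 hb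
          have hS : ({e | j e = b} : Finset (Fin 2 × Fin t)).Nonempty := ⟨e, by simpa using he⟩
          have h1 := block_weight_le hw hw1 hρ hρw hS
          refine le_of_mul_le_mul_left ?_ (by positivity : 0 < ρ ^ 2 * w)
          calc ρ ^ 2 * w * (ρ ^ (#(({e | j e = b} : Finset (Fin 2 × Fin t)).image Prod.fst) +
                  #(({e | j e = b} : Finset (Fin 2 × Fin t)).image Prod.snd)) * N)
              = (w * ρ ^ (#(({e | j e = b} : Finset (Fin 2 × Fin t)).image Prod.fst) +
                  #(({e | j e = b} : Finset (Fin 2 × Fin t)).image Prod.snd))) *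
                  (N * ρ ^ 2) := by ring
            _ ≤ (ρ ^ 2 * w ^ #({e | j e = b} : Finset (Fin 2 × Fin t))) * (θ * w) := by gcongr
            _ = _ := by ring

/-- Group the maps by image: at most N^b images have size b, which cancels the weight, and each is
the image of at most m^m maps, where m = |E| and b ≤ m. -/
theorem sum_inv_pow_card_image_le {E : Type*} [Fintype E] [DecidableEq E] {N : ℕ} (hN : 1 ≤ N) :
    ∑ j : E → Fin N, ((N : ℝ)⁻¹) ^ #(univ.image j) ≤
      (Fintype.card E + 1) * (Fintype.card E : ℝ) ^ Fintype.card E := by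
  have hN0 : (0 : ℝ) < N := by exact_mod_cast hN
  set m := Fintype.card E with hm
  let f : ℕ → ℝ := fun b => if b ≤ m then (m : ℝ) ^ m * ((N : ℝ)⁻¹) ^ b else 0
  have h1 : ∀ B : Finset (Fin N),
      ∑ j : E → Fin N with univ.image j = B, ((N : ℝ)⁻¹) ^ #(univ.image j) ≤ f #B := by
    intro B
    rw [sum_congr rfl (g := fun _ => ((N : ℝ)⁻¹) ^ #B) (fun j hj => by rw [(mem_filter.1 hj).2]),
      sum_const, nsmul_eq_mul]
    by_cases hB : #B ≤ m
    · simp only [f, hB, if_true]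
      gcongr
      have : #{j : E → Fin N | univ.image j = B} ≤ #B ^ m := by
        have hpi : #(Fintype.piFinset fun _ : E => B) = #B ^ m := by
          rw [Fintype.card_piFinset, prod_const, card_univ]
        rw [← hpi]
        apply card_le_card
        intro j hj
        simp only [mem_filter, mem_univ, true_and] at hj
        rw [Fintype.mem_piFinset]
        intro e
        rw [← hj]
        exact mem_image_of_mem _ (mem_univ _)
      exact_mod_cast this.trans (Nat.pow_le_pow_left hB m)
    · simp only [f, hB, if_false]
      rw [filter_false_of_mem, card_empty, Nat.cast_zero, zero_mul]
      rintro j - rfl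
      exact hB card_image_le
  calc ∑ j : E → Fin N, ((N : ℝ)⁻¹) ^ #(univ.image j)
      = ∑ B : Finset (Fin N), ∑ j : E → Fin N with univ.image j = B,
          ((N : ℝ)⁻¹) ^ #(univ.image j) :=
        (sum_fiberwise _ _ _).symm
    _ ≤ ∑ B : Finset (Fin N), f #B := sum_le_sum fun B _ => h1 B
    _ = ∑ b ∈ range (N + 1), (N.choose b) • f b := by
        rw [← powerset_univ, sum_powerset_apply_card]; simp
    _ ≤ ∑ b ∈ range (N + 1), if b ≤ m then (m : ℝ) ^ m else 0 := by
        refine sum_le_sum fun b _ => ?_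
        by_cases hb : b ≤ m
        · simp only [f, hb, if_true, nsmul_eq_mul]
          have : (N.choose b : ℝ) ≤ (N : ℝ) ^ b := by exact_mod_cast Nat.choose_le_pow N b
          calc (N.choose b : ℝ) * ((m : ℝ) ^ m * ((N : ℝ)⁻¹) ^ b)
              ≤ (N : ℝ) ^ b * ((m : ℝ) ^ m * ((N : ℝ)⁻¹) ^ b) := by gcongr
            _ = (m : ℝ) ^ m := by rw [inv_pow]; field_simp
        · simp [f, hb]
    _ ≤ ∑ b ∈ range (m + 1), (m : ℝ) ^ m := by
        rw [← sum_filter]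
        apply sum_le_sum_of_subset_of_nonneg
        · intro b hb
          simp only [mem_filter, mem_range] at hb ⊢
          omega
        · intros; positivity
    _ = _ := by simp

/-- An expectation written as a sum, M^{Nd} being the number of `F`. Each block used gains a factor
θ; taking q = 2 keeps two of them when blocks are too small to hold a whole K_{2,t}. -/
theorem sum_card_patterns_le {d M N t q : ℕ} (ht : 1 ≤ t) (hM : 1 ≤ M) (hN : 1 ≤ N) {w θ : ℝ}
    (hw : 0 < w) (hw1 : w ≤ 1) (hθ : 0 < θ) (hθ1 : θ ≤ 1)
    (hρw : ((M : ℝ)⁻¹) ^ t ≤ w ^ (2 * t - 1)) (hNw : N * ((M : ℝ)⁻¹) ^ 2 ≤ θ * w)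
    (hq : q = 0 ∨ q = 2 ∧ d < t + 2) :
    ∑ F : Fin N × Fin d → Fin M, (#(patterns t F) : ℝ) ≤
      M ^ (N * d) * (θ ^ q * ((2 * t + 1) * (2 * t) ^ (2 * t)) * (d * M) ^ (t + 2) *
        w ^ (2 * t)) := by
  classical
  have hM0 : (0 : ℝ) < M := by exact_mod_cast hM
  have hN0 : (0 : ℝ) < N := by exact_mod_cast hN
  have hswap : ∑ F : Fin N × Fin d → Fin M, (#(patterns t F) : ℝ) =
      ∑ p : Pattern d M N t, (#{F : Fin N × Fin d → Fin M | Realises F p} : ℝ) := by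
    simp only [patterns, card_filter]
    push_cast
    rw [sum_comm]
  have hp : ∀ p : Pattern d M N t, (#{F : Fin N × Fin d → Fin M | Realises F p} : ℝ) ≤
      M ^ (N * d) * (θ ^ q * w ^ (2 * t)) * ((N : ℝ)⁻¹) ^ #(univ.image p.2) := by
    intro p
    rcases Finset.eq_empty_or_nonempty {F : Fin N × Fin d → Fin M | Realises F p} with h | ⟨F, hF⟩
    · rw [h, card_empty, Nat.cast_zero]; positivity
    have hqi : q ≤ #(univ.image p.2) := by
      rcases hq with rfl | ⟨rfl, hd⟩
      · exact Nat.zero_le _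
      · exact (mem_filter.1 hF).2.two_le_card_image ht hd
    have h1 : (#{F : Fin N × Fin d → Fin M | Realises F p} : ℝ) * M ^ #(incidences p.2) ≤
        M ^ (N * d) := by exact_mod_cast card_realises_mul_le p
    have h2 := incidence_weight_le hw hw1 (inv_pos.2 hM0) (inv_le_one_of_one_le₀ (by
      exact_mod_cast hM)) hρw hNw p.2
    have h3 : θ ^ #(univ.image p.2) ≤ θ ^ q := pow_le_pow_of_le_one hθ.le hθ1 hqi
    rw [inv_pow, ← div_eq_mul_inv, le_div_iff₀ (by positivity)]
    calc (#{F : Fin N × Fin d → Fin M | Realises F p} : ℝ) * N ^ #(univ.image p.2)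
        = (#{F : Fin N × Fin d → Fin M | Realises F p} : ℝ) * M ^ #(incidences p.2) *
          (((M : ℝ)⁻¹) ^ #(incidences p.2) * N ^ #(univ.image p.2)) := by
          rw [inv_pow]; field_simp
      _ ≤ M ^ (N * d) * (θ ^ #(univ.image p.2) * w ^ (2 * t)) := by gcongr
      _ ≤ _ := by gcongr
  rw [hswap]
  calc ∑ p : Pattern d M N t, (#{F : Fin N × Fin d → Fin M | Realises F p} : ℝ)
      ≤ ∑ p : Pattern d M N t,
        M ^ (N * d) * (θ ^ q * w ^ (2 * t)) * ((N : ℝ)⁻¹) ^ #(univ.image p.2) :=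
        sum_le_sum fun p _ => hp p
    _ = M ^ (N * d) * (θ ^ q * w ^ (2 * t)) * ((d * M) ^ (t + 2) *
          ∑ j : Fin 2 × Fin t → Fin N, ((N : ℝ)⁻¹) ^ #(univ.image j)) := by
        rw [← mul_sum, ← univ_product_univ, sum_product]
        simp [add_comm 2 t]
    _ ≤ M ^ (N * d) * (θ ^ q * w ^ (2 * t)) * ((d * M) ^ (t + 2) *
          ((2 * t + 1) * (2 * t) ^ (2 * t))) := by
        gcongr
        have := sum_inv_pow_card_image_le (E := Fin 2 × Fin t) hN
        simpa using this
    _ = _ := by ring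

/-- Overwriting block j on A by arbitrary values loses nothing, because the old values can be read
off block i. -/
theorem card_filter_agree_mul_le {d M N : ℕ} (A : Finset (Fin d)) {i j : Fin N} (hij : i ≠ j) :
    #{F : Fin N × Fin d → Fin M | ∀ a ∈ A, F (i, a) = F (j, a)} * M ^ #A ≤ M ^ (N * d) := by
  classical
  have h1 : #(({F : Fin N × Fin d → Fin M | ∀ a ∈ A, F (i, a) = F (j, a)} :
      Finset (Fin N × Fin d → Fin M)) ×ˢ (univ : Finset (A → Fin M))) =
      #{F : Fin N × Fin d → Fin M | ∀ a ∈ A, F (i, a) = F (j, a)} * M ^ #A := by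
    rw [card_product, card_univ, Fintype.card_fun, Fintype.card_fin, Fintype.card_coe]
  have h2 : #(univ : Finset (Fin N × Fin d → Fin M)) = M ^ (N * d) := by
    simp
  rw [← h1, ← h2]
  apply card_le_card_of_injOn
    (fun q x => if h : x.1 = j ∧ x.2 ∈ A then q.2 ⟨x.2, h.2⟩ else q.1 x)
  · intro q _
    exact mem_coe.2 (mem_univ _)
  · rintro ⟨F, g⟩ hq ⟨F', g'⟩ hq' h
    simp only [coe_product, Set.mem_prod, mem_coe, mem_filter, mem_univ, true_and, and_true]
      at hq hq'
    have hF : ∀ x : Fin N × Fin d, ¬ (x.1 = j ∧ x.2 ∈ A) → F x = F' x := by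
      intro x hx
      simpa only [hx, dite_false] using congrFun h x
    refine Prod.ext (funext fun x => ?_) (funext fun a => ?_)
    · by_cases hx : x.1 = j ∧ x.2 ∈ A
      · obtain ⟨b, a⟩ := x
        obtain ⟨rfl, ha⟩ := hx
        change F (b, a) = F' (b, a)
        rw [← hq a ha, ← hq' a ha]
        exact hF _ fun h => hij h.1
      · exact hF x hx
    · simpa using congrFun h (j, (a : Fin d))

theorem two_mul_card_lt_le (N : ℕ) : 2 * #{p : Fin N × Fin N | p.1 < p.2} ≤ N ^ 2 := by
  have h1 : #{p : Fin N × Fin N | p.2 < p.1} = #{p : Fin N × Fin N | p.1 < p.2} :=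
    card_bij (fun p _ => p.swap) (by simp) (by simp) (by simp)
  have h2 : Disjoint ({p : Fin N × Fin N | p.1 < p.2} : Finset _)
      ({p : Fin N × Fin N | p.2 < p.1} : Finset _) := by
    rw [disjoint_left]
    intro p hp hp'
    simp only [mem_filter, mem_univ, true_and] at hp hp'
    exact lt_asymm hp hp'
  have h3 := card_le_univ (({p : Fin N × Fin N | p.1 < p.2} : Finset _) ∪
      ({p : Fin N × Fin N | p.2 < p.1} : Finset _))
  rw [card_union_of_disjoint h2, h1, Fintype.card_prod, Fintype.card_fin] at h3
  rw [sq]; omega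

theorem sum_card_coincidences_le {d M N : ℕ} (hM : 1 ≤ M)
    (hN : N * ((M : ℝ)⁻¹) ^ 2 ≤ 1) {A : Finset (Fin d)} (hA : 2 ≤ #A) :
    ∑ F : Fin N × Fin d → Fin M, (#(coincidences F A) : ℝ) ≤ M ^ (N * d) * (N / 2) := by
  have hM0 : (0 : ℝ) < M := by exact_mod_cast hM
  have hM1 : (1 : ℝ) ≤ M := by exact_mod_cast hM
  have hswap : ∑ F : Fin N × Fin d → Fin M, (#(coincidences F A) : ℝ) =
      ∑ p : Fin N × Fin N with p.1 < p.2,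
        (#{F : Fin N × Fin d → Fin M | ∀ a ∈ A, F (p.1, a) = F (p.2, a)} : ℝ) := by
    simp only [coincidences, ← filter_filter]
    simp only [card_filter (fun p : Fin N × Fin N => ∀ a ∈ A, _), card_filter]
    push_cast
    rw [sum_comm]
  have hp : ∀ p ∈ ({p : Fin N × Fin N | p.1 < p.2} : Finset _),
      (#{F : Fin N × Fin d → Fin M | ∀ a ∈ A, F (p.1, a) = F (p.2, a)} : ℝ) ≤
        M ^ (N * d) * ((M : ℝ)⁻¹) ^ 2 := by
    intro p hp
    have h1 : (#{F : Fin N × Fin d → Fin M | ∀ a ∈ A, F (p.1, a) = F (p.2, a)} : ℝ) * M ^ #A ≤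
        M ^ (N * d) := by
      exact_mod_cast card_filter_agree_mul_le A (ne_of_lt (mem_filter.1 hp).2)
    rw [inv_pow, ← div_eq_mul_inv, le_div_iff₀ (by positivity)]
    refine le_trans ?_ h1
    gcongr
  rw [hswap]
  refine (sum_le_card_nsmul _ _ _ hp).trans ?_
  rw [nsmul_eq_mul]
  have h2 : (2 : ℝ) * #{p : Fin N × Fin N | p.1 < p.2} ≤ N ^ 2 := by
    exact_mod_cast two_mul_card_lt_le N
  calc (#{p : Fin N × Fin N | p.1 < p.2} : ℝ) * (M ^ (N * d) * ((M : ℝ)⁻¹) ^ 2)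
      ≤ (N ^ 2 / 2) * (M ^ (N * d) * ((M : ℝ)⁻¹) ^ 2) := by gcongr; linarith
    _ = M ^ (N * d) * (N / 2) * (N * ((M : ℝ)⁻¹) ^ 2) := by ring
    _ ≤ M ^ (N * d) * (N / 2) * 1 := by gcongr
    _ = _ := mul_one _

/-- Averaging one weighted sum gives a single `F` that controls both quantities; the weight l is
left to the application. -/
theorem exists_few_coincidences_patterns {d M N t q r : ℕ} (ht : 1 ≤ t) (hr : 2 ≤ r) (hM : 1 ≤ M)
    (hN : 1 ≤ N) {w θ l : ℝ} (hw : 0 < w) (hw1 : w ≤ 1) (hθ : 0 < θ) (hθ1 : θ ≤ 1)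
    (hρw : ((M : ℝ)⁻¹) ^ t ≤ w ^ (2 * t - 1)) (hNw : N * ((M : ℝ)⁻¹) ^ 2 ≤ θ * w)
    (hq : q = 0 ∨ q = 2 ∧ d < t + 2) (hl : 0 ≤ l) :
    ∃ F : Fin N × Fin d → Fin M,
      (∑ A ∈ powersetCard r (univ : Finset (Fin d)), (#(coincidences F A) : ℝ)) +
        l * #(patterns t F) ≤ d.choose r * (N / 2) +
          l * (θ ^ q * ((2 * t + 1) * (2 * t) ^ (2 * t)) * (d * M) ^ (t + 2) * w ^ (2 * t)) := by
  have : Nonempty (Fin M) := ⟨⟨0, hM⟩⟩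
  have hN1 : N * ((M : ℝ)⁻¹) ^ 2 ≤ 1 := hNw.trans (by nlinarith)
  obtain ⟨F, -, hF⟩ := exists_le_of_sum_le (s := (univ : Finset (Fin N × Fin d → Fin M)))
    (f := fun F => (∑ A ∈ powersetCard r (univ : Finset (Fin d)), (#(coincidences F A) : ℝ)) +
        l * #(patterns t F))
    (g := fun _ => d.choose r * (N / 2) +
          l * (θ ^ q * ((2 * t + 1) * (2 * t) ^ (2 * t)) * (d * M) ^ (t + 2) * w ^ (2 * t)))
    univ_nonempty (by
      rw [sum_add_distrib, ← mul_sum, sum_comm, sum_const, card_univ, nsmul_eq_mul]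
      have h1 : ∑ A ∈ powersetCard r (univ : Finset (Fin d)), ∑ F : Fin N × Fin d → Fin M,
          (#(coincidences F A) : ℝ) ≤ d.choose r * (M ^ (N * d) * (N / 2)) := by
        have := sum_le_card_nsmul (powersetCard r (univ : Finset (Fin d)))
          (fun A => ∑ F : Fin N × Fin d → Fin M, (#(coincidences F A) : ℝ))
          (M ^ (N * d) * (N / 2))
          fun A hA => sum_card_coincidences_le hM hN1 (by rw [(mem_powersetCard.1 hA).2]; exact hr)
        simpa using this
      have h2 := mul_le_mul_of_nonneg_left
        (sum_card_patterns_le ht hM hN hw hw1 hθ hθ1 hρw hNw hq) hl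
      have h3 : (Fintype.card (Fin N × Fin d → Fin M) : ℝ) = M ^ (N * d) := by simp
      rw [h3]
      linarith)
  exact ⟨F, hF⟩

/-! ### The unconditional construction. -/

theorem exists_embedding_fin {d M n : ℕ} (h : d * M ≤ n) : Nonempty (Fin d × Fin M ↪ Fin n) :=
  Function.Embedding.nonempty_of_card_le (by simpa using h)

theorem exists_graph_dense {n d M N t r : ℕ} (ht : 1 ≤ t) (hr : 2 ≤ r) (hM : 1 ≤ M)
    (hN : 1 ≤ N) (hd : r ≤ d) (hn : d * M ≤ n) {w : ℝ} (hw : 0 < w) (hw1 : w ≤ 1)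
    (hρw : ((M : ℝ)⁻¹) ^ t ≤ w ^ (2 * t - 1)) (hNw : N * ((M : ℝ)⁻¹) ^ 2 ≤ w) :
    ∃ G : SimpleGraph (Fin n), d.choose r * (N / 4 : ℝ) ≤ numCliques r G ∧
      (numK2 t G : ℝ) ≤ 3 * (((2 * t + 1) * (2 * t) ^ (2 * t)) * n ^ (t + 2) * w ^ (2 * t)) := by
  obtain ⟨φ⟩ := exists_embedding_fin hn
  have htR : (1 : ℝ) ≤ t := by exact_mod_cast ht
  have hM0 : (0 : ℝ) < M := by exact_mod_cast hM
  have hN0 : (0 : ℝ) < N := by exact_mod_cast hN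
  have hd0 : (0 : ℝ) < d := by exact_mod_cast (by omega : 0 < d)
  have hC : (0 : ℝ) < d.choose r := by exact_mod_cast Nat.choose_pos hd
  obtain ⟨P, hP⟩ : ∃ P : ℝ,
    P = ((2 * t + 1) * (2 * t) ^ (2 * t)) * (d * M) ^ (t + 2) * w ^ (2 * t) := ⟨_, rfl⟩
  have hP0 : 0 < P := by rw [hP]; positivity
  -- This l makes the pattern term of the average a quarter of C(d, r) N. Coincidences then lose at
  -- most three quarters of the cliques, and there are at most 3P patterns.
  obtain ⟨F, hF⟩ := exists_few_coincidences_patterns (d := d) (l := d.choose r * N / (4 * P))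
    ht hr hM hN hw hw1 one_pos le_rfl hρw (by simpa using hNw) (.inl rfl) (by positivity)
  rw [pow_zero, one_mul, ← hP] at hF
  have h1 : (d.choose r : ℝ) * N / (4 * P) * P = d.choose r * N / 4 := by field_simp
  rw [h1] at hF
  refine ⟨blockGraph φ F univ, ?_, ?_⟩
  · have h2 := le_numCliques_blockGraph (r := r) φ F univ
    rw [card_univ, Fintype.card_fin] at h2
    have h3 : (d.choose r : ℝ) * N ≤ numCliques r (blockGraph φ F univ) +
      ∑ A ∈ powersetCard r (univ : Finset (Fin d)), (#(coincidences F A) : ℝ) := by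
      exact_mod_cast h2
    have h4 : 0 ≤ (d.choose r : ℝ) * N / (4 * P) * #(patterns t F) := by positivity
    linarith
  · have h2 : numK2 t (blockGraph φ F univ) ≤ #(patterns t F) :=
      (numK2_blockGraph_le ht φ F univ).trans (card_filter_le _ _)
    have h3 : 0 ≤ ∑ A ∈ powersetCard r (univ : Finset (Fin d)), (#(coincidences F A) : ℝ) := by
      positivity
    have h4 : (#(patterns t F) : ℝ) ≤ 3 * P := by
      have h5 : (d.choose r : ℝ) * N / (4 * P) * #(patterns t F) ≤
          d.choose r * N / (4 * P) * (3 * P) := by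
        have : (d.choose r : ℝ) * N / (4 * P) * (3 * P) = 3 * (d.choose r * N / 4) := by
          field_simp
        linarith
      exact le_of_mul_le_mul_left h5 (by positivity)
    calc (numK2 t (blockGraph φ F univ) : ℝ) ≤ #(patterns t F) := by exact_mod_cast h2
      _ ≤ 3 * P := h4
      _ ≤ _ := by
        rw [hP]
        gcongr
        exact_mod_cast hn

theorem exists_graph_free {n M N t r : ℕ} (ht : 1 ≤ t) (hr : 2 ≤ r) (hrt : r < t + 2) (hM : 1 ≤ M)
    (hN : 1 ≤ N) (hn : r * M ≤ n) {w θ : ℝ} (hw : 0 < w) (hw1 : w ≤ 1) (hθ : 0 < θ) (hθ1 : θ ≤ 1)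
    (hρw : ((M : ℝ)⁻¹) ^ t ≤ w ^ (2 * t - 1)) (hNw : N * ((M : ℝ)⁻¹) ^ 2 ≤ θ * w)
    (hP : θ ^ 2 * ((2 * t + 1) * (2 * t) ^ (2 * t)) * (r * M) ^ (t + 2) * w ^ (2 * t) ≤
      (N / 4 : ℝ)) :
    ∃ G : SimpleGraph (Fin n), (N / 4 : ℝ) ≤ numCliques r G ∧ numK2 t G = 0 := by
  obtain ⟨φ⟩ := exists_embedding_fin hn
  obtain ⟨F, hF⟩ := exists_few_coincidences_patterns (d := r) (l := 1)
    ht hr hM hN hw hw1 hθ hθ1 hρw hNw (.inr ⟨rfl, hrt⟩) zero_le_one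
  -- Alteration: one block of every realised pattern is discarded, which costs at most one block per
  -- pattern.
  set J : Finset (Fin N) := univ \ (patterns t F).image fun p => p.2 (0, ⟨0, ht⟩) with hJ
  refine ⟨blockGraph φ F J, ?_, ?_⟩
  · have h2 := le_numCliques_blockGraph (r := r) φ F J
    rw [Nat.choose_self, one_mul] at h2
    have h3 : N ≤ #J + #(patterns t F) := by
      have := le_card_sdiff ((patterns t F).image fun p => p.2 (0, ⟨0, ht⟩)) (univ : Finset (Fin N))
      rw [← hJ, card_univ, Fintype.card_fin] at this
      have h4 : #((patterns t F).image fun p => p.2 (0, ⟨0, ht⟩)) ≤ #(patterns t F) :=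
        card_image_le
      omega
    have h5 : (N : ℝ) ≤ numCliques r (blockGraph φ F J) +
      ∑ A ∈ powersetCard r (univ : Finset (Fin r)), (#(coincidences F A) : ℝ) +
        #(patterns t F) := by exact_mod_cast h3.trans (by omega)
    rw [Nat.choose_self] at hF
    push_cast at hF
    linarith
  · rw [← Nat.le_zero]
    refine (numK2_blockGraph_le ht φ F J).trans (le_of_eq ?_)
    rw [card_eq_zero, filter_eq_empty_iff]
    intro p hp hpJ
    have := hpJ (0, ⟨0, ht⟩)
    rw [hJ, mem_sdiff] at this
    exact this.2 (mem_image_of_mem (fun p : Pattern r M N t => p.2 (0, ⟨0, ht⟩)) hp)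

theorem exists_graph_single {n t r : ℕ} (ht : 1 ≤ t) (hrt : r < t + 2) (hn : r ≤ n) :
    ∃ G : SimpleGraph (Fin n), 1 ≤ numCliques r G ∧ numK2 t G = 0 := by
  obtain ⟨φ⟩ := exists_embedding_fin (by simpa using hn : r * 1 ≤ n)
  let F : Fin 1 × Fin r → Fin 1 := fun _ => 0
  refine ⟨blockGraph φ F univ, ?_, ?_⟩
  · have h := le_numCliques_blockGraph (r := r) φ F univ
    have h0 : ∀ A, coincidences F A = ∅ := by
      intro A
      rw [coincidences, filter_eq_empty_iff]
      rintro p - ⟨hp, -⟩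
      exact hp.ne (Subsingleton.elim _ _)
    simpa [h0] using h
  · rw [← Nat.le_zero]
    refine (numK2_blockGraph_le ht φ F univ).trans (le_of_eq ?_)
    rw [card_eq_zero, filter_eq_empty_iff]
    intro p hp _
    have := (mem_patterns.1 hp).two_le_card_image ht hrt
    have := card_le_univ (univ.image p.2)
    rw [Fintype.card_fin] at this
    omega

theorem half_le_natFloor {x : ℝ} (hx : 1 ≤ x) : x / 2 ≤ (⌊x⌋₊ : ℝ) := by
  have h1 : 1 ≤ ⌊x⌋₊ := Nat.one_le_floor_iff x |>.2 hx
  have h2 := Nat.lt_floor_add_one x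
  have h3 : (1 : ℝ) ≤ ⌊x⌋₊ := by exact_mod_cast h1
  linarith

theorem natFloor_mul_inv_sq_le {M : ℕ} (hM : 1 ≤ M) {x : ℝ} (hx : 0 ≤ x) :
    (⌊x * (M : ℝ) ^ 2⌋₊ : ℝ) * ((M : ℝ)⁻¹) ^ 2 ≤ x := by
  have hM0 : (0 : ℝ) < M := by exact_mod_cast hM
  have := Nat.floor_le (by positivity : 0 ≤ x * (M : ℝ) ^ 2)
  rw [inv_pow, ← div_eq_mul_inv, div_le_iff₀ (by positivity)]
  exact this

theorem exists_upper_bound_dense {t s n : ℕ} (ht : 2 ≤ t) {w ρ : ℝ}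
    (hw : 0 < w) (hw1 : w ≤ 1) (hρ : 0 < ρ) (hρw : ρ ^ t = w ^ (2 * t - 1))
    (hρn : 2 * ((s + 2 : ℕ) : ℝ) ≤ ρ * n) :
    ∃ G : SimpleGraph (Fin n),
      1 / (8 * ((s + 2 : ℕ) ^ (s + 2) * (s + 2).factorial) * 2 ^ (s + 2) * 2 ^ s) *
        (w * ρ ^ s * n ^ (s + 2)) ≤ (numCliques (s + 2) G : ℝ) ∧
      (numK2 t G : ℝ) ≤ 3 * ((2 * t + 1) * (2 * t) ^ (2 * t)) * (n ^ (t + 2) * w ^ (2 * t)) := by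
  have htR : (2 : ℝ) ≤ t := by exact_mod_cast ht
  have hρle : ρ ≤ w := by
    refine le_of_pow_le_pow_left₀ (n := t) (by omega) hw.le ?_
    rw [hρw]
    exact pow_le_pow_of_le_one hw.le hw1 (by omega)
  have hρ1 : ρ ≤ 1 := hρle.trans hw1
  -- Rounding up keeps 1/M ≤ ρ, as the weight estimates need, and costs at most a factor 2; the
  -- hypothesis ρn ≥ 2r then still leaves at least r classes.
  set M := ⌈1 / ρ⌉₊ with hM
  have hM1 : 1 / ρ ≤ M := Nat.le_ceil _
  have hM1' : 1 ≤ 1 / ρ := by rw [le_div_iff₀ hρ]; linarith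
  have hM2 : (M : ℝ) ≤ 2 / ρ := by
    have := Nat.ceil_lt_add_one (by positivity : 0 ≤ 1 / ρ)
    have h2 : 2 / ρ = 1 / ρ + 1 / ρ := by ring
    rw [h2]; linarith
  have hM0 : (1 : ℝ) ≤ M := hM1'.trans hM1
  have hMn : 1 ≤ M := by exact_mod_cast hM0
  have hMinv : (M : ℝ)⁻¹ ≤ ρ := by
    rw [inv_le_comm₀ (by linarith) hρ, ← one_div]; exact hM1
  set d := n / M with hd
  have hdr : s + 2 ≤ d := by
    rw [hd, Nat.le_div_iff_mul_le (by omega)]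
    have : ((s + 2 : ℕ) : ℝ) * M ≤ n := by
      calc ((s + 2 : ℕ) : ℝ) * M ≤ ((s + 2 : ℕ) : ℝ) * (2 / ρ) := by gcongr
        _ = 2 * ((s + 2 : ℕ) : ℝ) / ρ := by ring
        _ ≤ n := by rw [div_le_iff₀ hρ]; linarith
    exact_mod_cast this
  have hdn : (n : ℝ) ≤ 2 * (d * M) := by
    have h1 : n < (d + 1) * M := by
      rw [hd, mul_comm]; exact Nat.lt_mul_div_succ n (by omega)
    have h2 : (d + 1) * M ≤ 2 * (d * M) := by nlinarith
    exact_mod_cast (h1.trans_le h2).le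
  have hwM : 1 ≤ w * (M : ℝ) ^ 2 := by
    have h1 : (1 / ρ) ^ 2 ≤ (M : ℝ) ^ 2 := by gcongr
    have h2 : ρ ^ 2 ≤ w := by nlinarith
    calc (1 : ℝ) = ρ ^ 2 * (1 / ρ) ^ 2 := by field_simp
      _ ≤ w * (M : ℝ) ^ 2 := by gcongr
  set N := ⌊w * (M : ℝ) ^ 2⌋₊ with hN
  have hN1 : 1 ≤ N := (Nat.one_le_floor_iff _).2 hwM
  have hN2 : w * (M : ℝ) ^ 2 / 2 ≤ N := half_le_natFloor hwM
  obtain ⟨G, hG1, hG2⟩ := exists_graph_dense (r := s + 2) (by omega : 1 ≤ t) (by omega) hMn hN1 hdr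
    (Nat.div_mul_le_self n M) hw hw1
    (by rw [← hρw]; gcongr) (natFloor_mul_inv_sq_le hMn hw.le)
  refine ⟨G, le_trans ?_ hG1, hG2.trans (le_of_eq (by ring))⟩
  have hch := pow_le_mul_choose hdr
  set a : ℝ := (s + 2 : ℕ) ^ (s + 2) * (s + 2).factorial with ha
  have ha0 : 0 < a := by positivity
  rw [one_div_mul_eq_div, div_le_iff₀ (by positivity)]
  have h1 : (n : ℝ) ^ (s + 2) ≤ 2 ^ (s + 2) * (a * d.choose (s + 2)) * M ^ (s + 2) := by
    calc (n : ℝ) ^ (s + 2) ≤ (2 * (d * M)) ^ (s + 2) := by gcongr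
      _ = 2 ^ (s + 2) * (d : ℝ) ^ (s + 2) * M ^ (s + 2) := by ring
      _ ≤ _ := by gcongr
  have h2 : ρ ^ s * (M : ℝ) ^ s ≤ 2 ^ s := by
    rw [← mul_pow]
    gcongr
    rw [le_div_iff₀ hρ] at hM2
    linarith
  calc w * ρ ^ s * n ^ (s + 2)
      ≤ w * ρ ^ s * (2 ^ (s + 2) * (a * d.choose (s + 2)) * M ^ (s + 2)) := by gcongr
    _ = (ρ ^ s * M ^ s) * (a * 2 ^ (s + 2) * d.choose (s + 2)) * (w * M ^ 2) := by ring
    _ ≤ 2 ^ s * (a * 2 ^ (s + 2) * d.choose (s + 2)) * (2 * N) :=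
        mul_le_mul (mul_le_mul_of_nonneg_right h2 (by positivity)) (by linarith) (by positivity)
          (by positivity)
    _ = _ := by ring

/-- In the sparse range there are `K_{2,t}`-free graphs with enough cliques. -/
theorem exists_upper_bound_free {t s : ℕ} (ht : 2 ≤ t) (hst : s < t) :
    ∃ c : ℝ, 0 < c ∧ ∀ (n : ℕ) (w ρ : ℝ), s + 2 ≤ n → 0 < w → 0 < ρ →
      ρ ^ t = w ^ (2 * t - 1) → ρ * n ≤ 2 * ((s + 2 : ℕ) : ℝ) →
      ∃ G : SimpleGraph (Fin n),
        c * (w * ρ ^ s * n ^ (s + 2)) ≤ (numCliques (s + 2) G : ℝ) ∧ numK2 t G = 0 := by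
  have htR : (2 : ℝ) ≤ t := by exact_mod_cast ht
  set r : ℕ := s + 2 with hr
  have hrR : (2 : ℝ) ≤ r := by exact_mod_cast (by omega : 2 ≤ r)
  obtain ⟨B, hB⟩ : ∃ B : ℝ, B = (2 * t + 1) * (2 * t) ^ (2 * t) * r ^ (t + 2) := ⟨_, rfl⟩
  have hB1 : 1 ≤ B := by
    rw [hB]
    refine one_le_mul_of_one_le_of_one_le (one_le_mul_of_one_le_of_one_le ?_ ?_) ?_
    · linarith
    · exact one_le_pow₀ (by linarith)
    · exact one_le_pow₀ (by linarith)
  -- There are about θ v M² blocks, and the pattern bound is θ² B v M². This θ makes the latter at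
  -- most a quarter of the number of blocks.
  obtain ⟨θ, hθ⟩ : ∃ θ : ℝ, θ = 1 / (8 * B) := ⟨_, rfl⟩
  have hθ0 : 0 < θ := by rw [hθ]; positivity
  have hθ1 : θ ≤ 1 := by rw [hθ, div_le_one (by positivity)]; linarith
  obtain ⟨Q, hQ⟩ : ∃ Q : ℝ, Q = (2 * r) ^ s * (2 * r) * (2 * r) ^ 2 := ⟨_, rfl⟩
  have hQ0 : 0 < Q := by rw [hQ]; positivity
  refine ⟨θ / (8 * Q), by positivity, fun n w ρ hn hw hρ hρw hρn => ?_⟩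
  set M := n / r with hM
  have hM1 : 1 ≤ M := (Nat.one_le_div_iff (by omega)).2 hn
  have hMR : (1 : ℝ) ≤ M := by exact_mod_cast hM1
  have hrM : r * M ≤ n := Nat.mul_div_le n r
  have hMn : (M : ℝ) ≤ n := by exact_mod_cast Nat.div_le_self n r
  have hn2 : (n : ℝ) ≤ 2 * r * M := by
    have h1 : n < r * (M + 1) := Nat.lt_mul_div_succ n (by omega)
    have h2 : r * (M + 1) ≤ 2 * r * M := by nlinarith
    exact_mod_cast (h1.trans_le h2).le
  have hn0 : (0 : ℝ) < n := by linarith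
  -- v is the density balanced with relative block size 1/M. Since ρ ≤ 2r/n, the given w exceeds v
  -- by at most a constant factor.
  obtain ⟨v, hv0, hv⟩ : ∃ v : ℝ, 0 < v ∧ v ^ (2 * t - 1) = ((M : ℝ)⁻¹) ^ t := by
    refine ⟨(((M : ℝ)⁻¹) ^ t) ^ ((1 : ℝ) / (2 * t - 1 : ℕ)), by positivity, ?_⟩
    exact rpow_one_div_pow (by positivity) (by omega)
  have hv1 : v ≤ 1 := by
    by_contra! h
    have h1 : 1 < v ^ (2 * t - 1) := one_lt_pow₀ h (by omega)
    have h2 : ((M : ℝ)⁻¹) ^ t ≤ 1 := pow_le_one₀ (by positivity) (inv_le_one_of_one_le₀ hMR)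
    linarith
  have hwv : w ≤ 2 * r * v := by
    refine le_of_pow_le_pow_left₀ (n := 2 * t - 1) (by omega) (by positivity) ?_
    calc w ^ (2 * t - 1) = ρ ^ t := hρw.symm
      _ ≤ (2 * r / n) ^ t := by
          gcongr
          rw [le_div_iff₀ hn0]; exact hρn
      _ ≤ (2 * r / M) ^ t := by gcongr
      _ = (2 * r) ^ t * ((M : ℝ)⁻¹) ^ t := by rw [← mul_pow, div_eq_mul_inv]
      _ ≤ (2 * r) ^ (2 * t - 1) * ((M : ℝ)⁻¹) ^ t := by
          gcongr
          · linarith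
          · omega
      _ = (2 * r * v) ^ (2 * t - 1) := by rw [← hv, ← mul_pow]
  have hK : w * ρ ^ s * n ^ (s + 2) ≤ Q * (v * M ^ 2) := by
    calc w * ρ ^ s * n ^ (s + 2) = (ρ * n) ^ s * w * n ^ 2 := by ring
      _ ≤ (2 * r) ^ s * (2 * r * v) * (2 * r * M) ^ 2 := by gcongr
      _ = _ := by rw [hQ]; ring
  -- In the first case the number of blocks would round down to 0, but the required clique count is
  -- below 1 and a single r-clique suffices.
  rcases lt_or_ge (θ * v * (M : ℝ) ^ 2) 1 with hsmall | hlarge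
  · obtain ⟨G, hG1, hG2⟩ := exists_graph_single (by omega : 1 ≤ t) (by omega : r < t + 2) hn
    refine ⟨G, ?_, hG2⟩
    have h1 : (1 : ℝ) ≤ numCliques r G := by exact_mod_cast hG1
    refine le_trans ?_ h1
    calc θ / (8 * Q) * (w * ρ ^ s * n ^ (s + 2)) ≤ θ / (8 * Q) * (Q * (v * M ^ 2)) := by gcongr
      _ = θ * v * M ^ 2 / 8 := by field_simp
      _ ≤ 1 := by linarith
  · set N := ⌊θ * v * (M : ℝ) ^ 2⌋₊ with hN
    have hN1 : 1 ≤ N := (Nat.one_le_floor_iff _).2 hlarge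
    have hN2 : θ * v * (M : ℝ) ^ 2 / 2 ≤ N := half_le_natFloor hlarge
    have hP : θ ^ 2 * ((2 * t + 1) * (2 * t) ^ (2 * t)) * (r * M) ^ (t + 2) * v ^ (2 * t) ≤
        (N / 4 : ℝ) := by
      have h1 : v ^ (2 * t) * (M : ℝ) ^ t = v := by
        rw [show 2 * t = (2 * t - 1) + 1 by omega, pow_succ, hv, inv_pow]
        field_simp
      calc θ ^ 2 * ((2 * t + 1) * (2 * t) ^ (2 * t)) * (r * M) ^ (t + 2) * v ^ (2 * t)
          = θ ^ 2 * B * (v ^ (2 * t) * (M : ℝ) ^ t) * M ^ 2 := by rw [hB]; ring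
        _ = θ * B * (θ * v * M ^ 2) := by rw [h1]; ring
        _ = (θ * v * M ^ 2) / 8 := by
            rw [show θ * B = 1 / 8 by rw [hθ]; field_simp]; ring
        _ ≤ N / 4 := by linarith
    obtain ⟨G, hG1, hG2⟩ := exists_graph_free (r := r) (by omega : 1 ≤ t) (by omega) (by omega)
      hM1 hN1 hrM hv0 hv1 hθ0 hθ1 hv.ge (natFloor_mul_inv_sq_le hM1 (by positivity)) hP
    refine ⟨G, le_trans ?_ hG1, hG2⟩
    calc θ / (8 * Q) * (w * ρ ^ s * n ^ (s + 2)) ≤ θ / (8 * Q) * (Q * (v * M ^ 2)) := by gcongr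
      _ = (θ * v * M ^ 2 / 2) / 4 := by field_simp; norm_num
      _ ≤ N / 4 := by gcongr

theorem denseBound_nonneg (t r n : ℕ) {k : ℝ} (hk : 0 < k) : 0 ≤ denseBound t r n k := by
  rw [denseBound]; positivity

theorem sparseBound_nonneg (t r n : ℕ) {k : ℝ} (hk : 0 < k) : 0 ≤ sparseBound t r n k := by
  rw [sparseBound]; positivity

theorem numK2_eq_zero_of_zero {t : ℕ} (G : SimpleGraph (Fin 0)) : numK2 t G = 0 := by
  classical
  rw [← Nat.le_zero]
  refine (numK2_le_card t G).trans (le_of_eq ?_)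
  rw [card_eq_zero, filter_eq_empty_iff]
  exact fun v => (v (.inl 0)).elim0

theorem exists_dense_construction {t r : ℕ} (ht : 2 ≤ t) (hr : 2 < r) (hrt : r < 2 + t) :
    ∃ c C : ℝ, 0 < c ∧ 0 < C ∧ ∀ (n : ℕ) (k : ℝ), 0 < k →
      k * (n : ℝ) ^ ((3 : ℝ) / 2) ≤ (n.choose r : ℝ) →
      ∃ G : SimpleGraph (Fin n),
        c * (k * (n : ℝ) ^ ((3 : ℝ) / 2)) ≤ (numCliques r G : ℝ) ∧
        (numK2 t G : ℝ) ≤ C * denseBound t r n k := by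
  obtain ⟨s, rfl⟩ : ∃ s, r = s + 2 := ⟨r - 2, by omega⟩
  obtain ⟨c₁, hc₁, hfree⟩ := exists_upper_bound_free ht (by omega : s < t)
  obtain ⟨c₂, hc₂, hc₂'⟩ : ∃ c₂ : ℝ, 0 < c₂ ∧ c₂ =
    1 / (8 * ((s + 2 : ℕ) ^ (s + 2) * (s + 2).factorial) * 2 ^ (s + 2) * 2 ^ s) :=
    ⟨_, by positivity, rfl⟩
  have htR : (2 : ℝ) ≤ t := by exact_mod_cast ht
  refine ⟨min c₁ c₂, 3 * ((2 * t + 1) * (2 * t) ^ (2 * t)), lt_min hc₁ hc₂, by positivity,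
    fun n k hk hK => ?_⟩
  have hD := denseBound_nonneg t (s + 2) n hk
  rcases Nat.eq_zero_or_pos n with rfl | hn
  · refine ⟨⊥, ?_, ?_⟩
    · rw [Nat.cast_zero, Real.zero_rpow (by norm_num), mul_zero, mul_zero]; positivity
    · rw [numK2_eq_zero_of_zero, Nat.cast_zero]; positivity
  have hn0 : (0 : ℝ) < n := by exact_mod_cast hn
  have hrn : s + 2 ≤ n := by
    by_contra! h
    rw [Nat.choose_eq_zero_of_lt h, Nat.cast_zero] at hK
    have : 0 < k * (n : ℝ) ^ ((3 : ℝ) / 2) := by positivity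
    linarith
  obtain ⟨w, ρ, hw, hρ, hρw, hKw, hDw, hw1⟩ := exists_density_params (n := n) ht hr hn hk
  rw [Nat.add_sub_cancel] at hKw
  have hK0 : 0 ≤ w * ρ ^ s * (n : ℝ) ^ (s + 2) := by positivity
  rw [hKw]
  -- Blocks of size about ρn can contain r-cliques only in the first case; otherwise blocks of size
  -- exactly r are used.
  rcases le_total (2 * ((s + 2 : ℕ) : ℝ)) (ρ * n) with h | h
  · obtain ⟨G, hG1, hG2⟩ := exists_upper_bound_dense ht hw
      (hw1 (hK.trans (by exact_mod_cast Nat.choose_le_pow n (s + 2)))) hρ hρw h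
    refine ⟨G, le_trans ?_ hG1, by rw [hDw]; exact hG2⟩
    rw [← hc₂']
    gcongr
    exact min_le_right _ _
  · obtain ⟨G, hG1, hG2⟩ := hfree n w ρ hrn hw hρ hρw h
    refine ⟨G, le_trans ?_ hG1, ?_⟩
    · gcongr
      exact min_le_left _ _
    · rw [hG2, Nat.cast_zero]; positivity

/-! ### The conditional construction: cliques on chunks of neighbourhoods. -/

theorem exists_disjoint_subsets {α : Type*} [DecidableEq α] {q : ℕ} (hq : 1 ≤ q) (j : ℕ)
    (S : Finset α) (h : j * q ≤ #S) : ∃ P : Finset (Finset α), #P = j ∧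
      (∀ c ∈ P, c ⊆ S ∧ #c = q) ∧ ∀ c ∈ P, ∀ c' ∈ P, c ≠ c' → Disjoint c c' := by
  induction j generalizing S with
  | zero => exact ⟨∅, by simp⟩
  | succ j ih =>
    obtain ⟨c, hcS, hc⟩ := exists_subset_card_eq (by nlinarith : q ≤ #S)
    obtain ⟨P, hP, hPS, hPd⟩ := ih (S \ c) (by
      rw [card_sdiff_of_subset hcS, hc]
      have : (j + 1) * q = j * q + q := by ring
      omega)
    have hdisj : ∀ c' ∈ P, Disjoint c c' := fun c' hc' =>
      disjoint_of_subset_right (hPS c' hc').1 disjoint_sdiff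
    have hcP : c ∉ P := by
      intro hcP
      have := hdisj c hcP
      rw [disjoint_self_iff_empty] at this
      rw [this, card_empty] at hc
      omega
    refine ⟨insert c P, by rw [card_insert_of_notMem hcP, hP], ?_, ?_⟩
    · intro x hx
      rcases mem_insert.1 hx with rfl | hx
      · exact ⟨hcS, hc⟩
      · exact ⟨(hPS x hx).1.trans sdiff_subset, (hPS x hx).2⟩
    · intro x hx y hy hxy
      rcases mem_insert.1 hx with rfl | hx' <;> rcases mem_insert.1 hy with rfl | hy'
      · exact (hxy rfl).elim
      · exact hdisj y hy'
      · exact (hdisj x hx').symm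
      · exact hPd x hx' y hy' hxy

theorem exists_path_two {m n : ℕ} {B : SimpleGraph (Fin m ⊕ Fin n)} {x y : Fin n} {a : Fin m}
    (hxy : x ≠ y) (hx : B.Adj (.inl a) (.inr x)) (hy : B.Adj (.inl a) (.inr y)) :
    ∃ p : B.Path (.inr x) (.inr y), p.1.length ≤ 4 ∧
      p.1.support = [.inr x, .inl a, .inr y] :=
  ⟨⟨.cons hx.symm (.cons hy .nil), by simp [hxy]⟩, by simp, by simp⟩

theorem exists_path_four {m n : ℕ} {B : SimpleGraph (Fin m ⊕ Fin n)} {x y z : Fin n} {a b : Fin m}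
    (hxy : x ≠ y) (hxz : x ≠ z) (hzy : z ≠ y) (hab : a ≠ b) (h1 : B.Adj (.inl a) (.inr x))
    (h2 : B.Adj (.inl a) (.inr z)) (h3 : B.Adj (.inl b) (.inr z)) (h4 : B.Adj (.inl b) (.inr y)) :
    ∃ p : B.Path (.inr x) (.inr y), p.1.length ≤ 4 ∧
      p.1.support = [.inr x, .inl a, .inr z, .inl b, .inr y] :=
  ⟨⟨.cons h1.symm (.cons h2 (.cons h3.symm (.cons h4 .nil))), by simp [hxy, hxz, hzy, hab]⟩,
    by simp, by simp⟩

theorem FewShortPaths.card_lt {m n t : ℕ} {B : SimpleGraph (Fin m ⊕ Fin n)}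
    (hB : FewShortPaths t B) {x y : Fin n} (hxy : x ≠ y) {α : Type*} (T : Finset α)
    (g : α → List (Fin m ⊕ Fin n)) (hg : Set.InjOn g T)
    (h : ∀ a ∈ T, ∃ p : B.Path (.inr x) (.inr y), p.1.length ≤ 4 ∧ p.1.support = g a) :
    #T < t := by
  have h1 := hB x y hxy
  choose f hf using fun a : T => h a.1 a.2
  have hinj : Function.Injective f := fun a b hab => Subtype.ext <| hg a.2 b.2 <| by
    rw [← (hf a).2, ← (hf b).2, hab]
  have h2 : (Set.range f).encard ≤ {p : B.Path (.inr x) (.inr y) | p.1.length ≤ 4}.encard := by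
    apply Set.encard_le_encard
    rintro _ ⟨a, rfl⟩
    exact (hf a).1
  rw [← Set.image_univ, hinj.encard_image, Set.encard_univ, ENat.card_eq_coe_fintype_card,
    Fintype.card_coe] at h2
  exact_mod_cast h2.trans_lt h1

/-- The union of the cliques on the second components of the members of `D`. -/
def chunkGraph {m n : ℕ} (D : Finset (Σ _ : Fin m, Finset (Fin n))) : SimpleGraph (Fin n) where
  Adj u v := u ≠ v ∧ ∃ x ∈ D, u ∈ x.2 ∧ v ∈ x.2
  symm := ⟨fun _ _ ⟨h, x, hx, hu, hv⟩ => ⟨h.symm, x, hx, hv, hu⟩⟩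
  loopless := ⟨fun _ h => h.1 rfl⟩

/-- `D` consists of disjoint pieces of size `q` of the neighbourhoods of vertices of the first part
of `B`, each with the vertex it comes from. -/
structure IsChunking {m n : ℕ} (B : SimpleGraph (Fin m ⊕ Fin n)) (q : ℕ)
    (D : Finset (Σ _ : Fin m, Finset (Fin n))) : Prop where
  adj : ∀ x ∈ D, ∀ v ∈ x.2, B.Adj (.inl x.1) (.inr v)
  card_eq : ∀ x ∈ D, #x.2 = q
  eq_of_mem : ∀ x ∈ D, ∀ y ∈ D, x.1 = y.1 → ∀ v, v ∈ x.2 → v ∈ y.2 → x = y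

namespace IsChunking

variable {m n t q : ℕ} {B : SimpleGraph (Fin m ⊕ Fin n)} {D : Finset (Σ _ : Fin m, Finset (Fin n))}

/-- Chunks of one vertex of U are disjoint, so the chunks through u and v come from different
vertices of U and give different paths of length 2. -/
theorem card_common_lt (hD : IsChunking B q D) (hB : FewShortPaths t B) {u v : Fin n}
    (huv : u ≠ v) : #{x ∈ D | u ∈ x.2 ∧ v ∈ x.2} < t := by
  refine hB.card_lt huv _ (fun x => [.inr u, .inl x.1, .inr v]) ?_ ?_
  · intro x hx y hy hxy
    simp only [coe_filter, Set.mem_ofPred_eq] at hx hy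
    exact hD.eq_of_mem x hx.1 y hy.1 (by simpa using hxy) u hx.2.1 hy.2.1
  · intro x hx
    simp only [mem_filter] at hx
    exact exists_path_two huv (hD.adj x hx.1 u hx.2.1) (hD.adj x hx.1 v hx.2.2)

open Classical in
/-- The vertices `w` joined to `u` and to `v` in blocks from different vertices of `B`. -/
noncomputable def crossNbrs (D : Finset (Σ _ : Fin m, Finset (Fin n))) (u v : Fin n) :
    Finset (Fin n) :=
  {w | u ≠ w ∧ w ≠ v ∧ ∃ x ∈ D, ∃ y ∈ D, x.1 ≠ y.1 ∧ u ∈ x.2 ∧ w ∈ x.2 ∧ w ∈ y.2 ∧ v ∈ y.2}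

theorem card_crossNbrs_lt (hD : IsChunking B q D) (hB : FewShortPaths t B) {u v : Fin n}
    (huv : u ≠ v) : #(crossNbrs D u v) < t := by
  -- Each cross neighbour w is the middle of a path of length 4 and is recovered as the only vertex
  -- of V on it besides u and v, so distinct w give distinct paths.
  have h : ∀ w : Fin n, ∃ g : List (Fin m ⊕ Fin n), w ∈ crossNbrs D u v →
      (.inr w ∈ g ∧ ∀ z, .inr z ∈ g → z = u ∨ z = v ∨ z = w) ∧
      ∃ p : B.Path (.inr u) (.inr v), p.1.length ≤ 4 ∧ p.1.support = g := by
    intro w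
    by_cases hw : w ∈ crossNbrs D u v
    · have hw' := hw
      simp only [crossNbrs, mem_filter, mem_univ, true_and] at hw'
      obtain ⟨h1, h2, x, hx, y, hy, hxy, hux, hwx, hwy, hvy⟩ := hw'
      refine ⟨[.inr u, .inl x.1, .inr w, .inl y.1, .inr v], fun _ => ⟨by simp, ?_⟩⟩
      exact exists_path_four huv h1 h2 hxy (hD.adj x hx u hux) (hD.adj x hx w hwx)
        (hD.adj y hy w hwy) (hD.adj y hy v hvy)
    · exact ⟨[], fun h => (hw h).elim⟩
  choose g hg using h
  refine hB.card_lt huv _ g ?_ fun w hw => (hg w hw).2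
  intro w hw w' hw' hgg
  have h1 := (hg w hw).1.1
  rw [hgg] at h1
  have h2 := (hg w' hw').1.2 w h1
  rw [mem_coe, crossNbrs, mem_filter] at hw
  rcases h2 with h | h | h
  · exact (hw.2.1 h.symm).elim
  · exact (hw.2.2.1 h).elim
  · exact h

/-- If the edges uw and vw come from chunks of the same vertex of U, those chunks share w and hence
coincide. -/
theorem commonNbrs_subset (hD : IsChunking B q D) (u v : Fin n) :
    commonNbrs (chunkGraph D) u v ⊆
      crossNbrs D u v ∪ ({x ∈ D | u ∈ x.2 ∧ v ∈ x.2} : Finset _).biUnion fun x => x.2 := by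
  intro w hw
  obtain ⟨⟨huw, x, hx, hux, hwx⟩, hvw, y, hy, hvy, hwy⟩ := mem_commonNbrs.1 hw
  by_cases hxy : x.1 = y.1
  · obtain rfl := hD.eq_of_mem x hx y hy hxy w hwx hwy
    exact mem_union_right _ (mem_biUnion.2 ⟨x, mem_filter.2 ⟨hx, hux, hvy⟩, hwx⟩)
  · apply mem_union_left
    simp only [crossNbrs, mem_filter, mem_univ, true_and]
    exact ⟨huw, hvw.symm, x, hx, y, hy, hxy, hux, hwx, hwy, hvy⟩

theorem card_commonNbrs_le (hD : IsChunking B q D) (hB : FewShortPaths t B) {u v : Fin n}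
    (huv : u ≠ v) : #(commonNbrs (chunkGraph D) u v) ≤ t + t * q := by
  refine (card_le_card (hD.commonNbrs_subset u v)).trans ((card_union_le _ _).trans ?_)
  refine Nat.add_le_add (hD.card_crossNbrs_lt hB huv).le ?_
  refine (card_biUnion_le_card_mul _ _ q fun x hx => (hD.card_eq x (mem_filter.1 hx).1).le).trans ?_
  exact Nat.mul_le_mul_right _ (hD.card_common_lt hB huv).le

theorem card_mul_choose_le (hD : IsChunking B q D) (hB : FewShortPaths t B) {r : ℕ} (hr : 2 ≤ r) :
    #D * q.choose r ≤ numCliques r (chunkGraph D) * t := by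
  classical
  rw [numCliques_eq_card]
  apply card_mul_le_card_mul (fun x R => R ⊆ x.2)
  · intro x hx
    rw [← hD.card_eq x hx, ← card_powersetCard]
    apply card_le_card
    intro R hR
    rw [mem_powersetCard] at hR
    simp only [bipartiteAbove, mem_filter, mem_univ, true_and]
    exact ⟨⟨fun u hu v hv huv => ⟨huv, x, hx, hR.1 hu, hR.1 hv⟩, hR.2⟩, hR.1⟩
  · intro R hR
    simp only [mem_filter, mem_univ, true_and] at hR
    obtain ⟨u, hu, v, hv, huv⟩ := one_lt_card.1 (by rw [hR.card_eq]; omega : 1 < #R)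
    refine le_trans (card_le_card ?_) (hD.card_common_lt hB huv).le
    intro x hx
    simp only [bipartiteBelow, mem_filter] at hx ⊢
    exact ⟨hx.1, hx.2 hu, hx.2 hv⟩

theorem numK2_le (hD : IsChunking B q D) (hB : FewShortPaths t B) :
    numK2 t (chunkGraph D) ≤ #D * q ^ 2 * (t + t * q) ^ t := by
  classical
  set P : Finset (Fin n × Fin n) := (D.biUnion fun x => x.2 ×ˢ x.2).filter fun p => p.1 ≠ p.2
    with hP
  have hPc : #P ≤ #D * q ^ 2 := by
    refine (card_filter_le _ _).trans (card_biUnion_le_card_mul _ _ _ fun x hx => ?_)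
    rw [card_product, hD.card_eq x hx, sq]
  let T : Finset (Σ _ : Fin n × Fin n, Fin t → Fin n) :=
    P.sigma fun p => Fintype.piFinset fun _ => commonNbrs (chunkGraph D) p.1 p.2
  have hT : #T ≤ #P * (t + t * q) ^ t := by
    rw [card_sigma]
    apply sum_le_card_nsmul
    intro p hp
    rw [Fintype.card_piFinset, prod_const, card_univ, Fintype.card_fin]
    exact Nat.pow_le_pow_left (hD.card_commonNbrs_le hB (mem_filter.1 hp).2) _
  refine (numK2_le_card t _).trans (le_trans ?_ (hT.trans (Nat.mul_le_mul_right _ hPc)))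
  apply card_le_card_of_injOn
    (fun v => (⟨(v (.inl 0), v (.inl 1)), fun z => v (.inr z)⟩ : Σ _ : Fin n × Fin n, Fin t → Fin n))
  · intro v hv
    simp only [coe_filter, mem_univ, true_and, Set.mem_ofPred_eq] at hv
    have hne : v (.inl 0) ≠ v (.inl 1) := fun h => by simpa using hv.1 h
    have hcn : ∀ z, v (.inr z) ∈ commonNbrs (chunkGraph D) (v (.inl 0)) (v (.inl 1)) :=
      fun z => mem_commonNbrs.2 ⟨hv.2 0 z, hv.2 1 z⟩
    -- Fewer than t cross neighbours exist, so some leaf of the K_{2,t} shares one chunk with both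
    -- centres. This leaves at most |D| q² choices of centres.
    have hex : ∃ z, v (.inr z) ∉ crossNbrs D (v (.inl 0)) (v (.inl 1)) := by
      by_contra! hall
      have h1 : #(univ.image fun z => v (.inr z)) ≤ #(crossNbrs D (v (.inl 0)) (v (.inl 1))) := by
        apply card_le_card
        intro w hw
        obtain ⟨z, -, rfl⟩ := mem_image.1 hw
        exact hall z
      rw [card_image_of_injective _ fun z z' h => by simpa using hv.1 h, card_univ,
        Fintype.card_fin] at h1
      have := hD.card_crossNbrs_lt hB hne
      omega
    obtain ⟨z, hz⟩ := hex
    have h1 := (mem_union.1 (hD.commonNbrs_subset _ _ (hcn z))).resolve_left hz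
    obtain ⟨x, hx, -⟩ := mem_biUnion.1 h1
    rw [mem_filter] at hx
    simp only [T, coe_sigma, Set.mem_sigma_iff, mem_coe, Fintype.mem_piFinset]
    exact ⟨mem_filter.2 ⟨mem_biUnion.2 ⟨x, hx.1, mem_product.2 hx.2⟩, hne⟩, hcn⟩
  · intro v _ v' _ h
    simp only [Sigma.mk.injEq, Prod.mk.injEq, heq_eq_eq] at h
    funext x
    rcases x with i | z
    · fin_cases i
      · exact h.1.1
      · exact h.1.2
    · exact congrFun h.2 z

end IsChunking

open Classical in
/-- The neighbourhood in the second part of a vertex of the first part. -/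
noncomputable def rightNbrs {m n : ℕ} (B : SimpleGraph (Fin m ⊕ Fin n)) (u : Fin m) :
    Finset (Fin n) :=
  {v | B.Adj (.inl u) (.inr v)}

theorem ncard_edgeSet_le_sum {m n : ℕ} {B : SimpleGraph (Fin m ⊕ Fin n)}
    (hB : B ≤ completeBipartiteGraph (Fin m) (Fin n)) :
    B.edgeSet.ncard ≤ ∑ u, #(rightNbrs B u) := by
  classical
  rw [← card_sigma, ← Set.ncard_coe_finset]
  refine (Set.ncard_le_ncard ?_ ((finite_toSet _).image _)).trans
    (Set.ncard_image_le (f := fun x : Σ _ : Fin m, Fin n => s(.inl x.1, .inr x.2))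
      (finite_toSet _))
  intro e he
  induction e with
  | _ a b =>
    have h := hB he
    rcases a with a | a <;> rcases b with b | b <;> simp at h
    · exact ⟨⟨a, b⟩, by simpa [rightNbrs] using he, rfl⟩
    · exact ⟨⟨b, a⟩, by simpa [rightNbrs, B.adj_comm] using he, Sym2.eq_swap⟩

theorem exists_isChunking {m n q h : ℕ} (hq : 1 ≤ q) (B : SimpleGraph (Fin m ⊕ Fin n))
    (hh : h ≤ ∑ u, #(rightNbrs B u) / q) :
    ∃ D : Finset (Σ _ : Fin m, Finset (Fin n)), IsChunking B q D ∧ #D = h := by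
  choose P hPc hP hPd using fun u =>
    exists_disjoint_subsets hq (#(rightNbrs B u) / q) (rightNbrs B u) (Nat.div_mul_le_self _ _)
  obtain ⟨D, hD, hDc⟩ := exists_subset_card_eq (s := univ.sigma P) (n := h) (by
    rw [card_sigma]; simpa [hPc] using hh)
  have hD' : ∀ x ∈ D, x.2 ∈ P x.1 := fun x hx => (mem_sigma.1 (hD hx)).2
  refine ⟨D, ⟨?_, ?_, ?_⟩, hDc⟩
  · intro x hx v hv
    have := (hP x.1 x.2 (hD' x hx)).1 hv
    simpa [rightNbrs] using this
  · intro x hx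
    exact (hP x.1 x.2 (hD' x hx)).2
  · rintro ⟨a, c⟩ hx ⟨b, c'⟩ hy hab v hvx hvy
    obtain rfl : a = b := hab
    by_contra hne
    have := hPd a c (hD' _ hx) c' (hD' _ hy) (fun h => hne (by rw [h]))
    exact disjoint_left.1 this hvx hvy

theorem exists_graph_of_chunking_bounds {t s n m h q : ℕ} {B : SimpleGraph (Fin m ⊕ Fin n)}
    {D : Finset (Σ _ : Fin m, Finset (Fin n))} (ht : 1 ≤ t) (hD : IsChunking B q D)
    (hB : FewShortPaths t B) (hDh : #D = h) (hq : s + 2 ≤ q) {b δ H : ℝ} (hb : 0 < b) (hδ : 0 < δ)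
    (hH : 0 < H) (hq1 : b * δ / 4 ≤ q) (hq2 : (q : ℝ) ≤ b * δ) (hh1 : H ≤ h)
    (hh2 : (h : ℝ) ≤ 2 * H) :
    (b / 4) ^ (s + 2) / (t * ((s + 2 : ℕ) ^ (s + 2) * (s + 2).factorial)) *
        (δ ^ s * (H * δ ^ 2)) ≤ (numCliques (s + 2) (chunkGraph D) : ℝ) ∧
      (numK2 t (chunkGraph D) : ℝ) ≤ 2 * b ^ (t + 2) * (2 * t) ^ t * (δ ^ t * (H * δ ^ 2)) := by
  have htR : (1 : ℝ) ≤ t := by exact_mod_cast ht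
  constructor
  · have h1 : (h : ℝ) * q.choose (s + 2) ≤ numCliques (s + 2) (chunkGraph D) * t := by
      rw [← hDh]
      exact_mod_cast hD.card_mul_choose_le hB (by omega : 2 ≤ s + 2)
    have h2 := pow_le_mul_choose hq
    set a : ℝ := (s + 2 : ℕ) ^ (s + 2) * (s + 2).factorial with ha
    have ha0 : 0 < a := by positivity
    rw [div_mul_eq_mul_div, div_le_iff₀ (by positivity)]
    calc (b / 4) ^ (s + 2) * (δ ^ s * (H * δ ^ 2)) = H * (b * δ / 4) ^ (s + 2) := by ring
      _ ≤ h * (q : ℝ) ^ (s + 2) := by gcongr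
      _ ≤ h * (a * q.choose (s + 2)) := by gcongr
      _ = a * (h * q.choose (s + 2)) := by ring
      _ ≤ a * (numCliques (s + 2) (chunkGraph D) * t) := by gcongr
      _ = _ := by ring
  · have h1 : (numK2 t (chunkGraph D) : ℝ) ≤ h * q ^ 2 * (t + t * q) ^ t := by
      rw [← hDh]
      exact_mod_cast hD.numK2_le hB
    have hqR : (1 : ℝ) ≤ q := by exact_mod_cast (by omega : 1 ≤ q)
    calc (numK2 t (chunkGraph D) : ℝ) ≤ h * q ^ 2 * (t + t * q) ^ t := h1
      _ ≤ 2 * H * (b * δ) ^ 2 * (2 * t * (b * δ)) ^ t := by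
          gcongr
          nlinarith
      _ = _ := by ring

theorem sum_div_lower_bound {m q : ℕ} (hq : 1 ≤ q) (f : Fin m → ℕ) :
    (∑ u, (f u : ℝ)) / q - m ≤ ((∑ u, f u / q : ℕ) : ℝ) := by
  have hq0 : (0 : ℝ) < q := by exact_mod_cast hq
  have h1 : ∑ u, ((f u : ℝ) / q - 1) ≤ ∑ u, ((f u / q : ℕ) : ℝ) := by
    refine sum_le_sum fun u _ => ?_
    rw [sub_le_iff_le_add, div_le_iff₀ hq0]
    have h : f u < q * (f u / q + 1) := Nat.lt_mul_div_succ _ (by omega)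
    have : (f u : ℝ) ≤ q * (((f u / q : ℕ) : ℝ) + 1) := by exact_mod_cast h.le
    linarith
  rw [sum_sub_distrib, ← sum_div] at h1
  simpa using h1

theorem rpow_neg_two_div {k : ℝ} (hk : 0 < k) (s : ℕ) :
    k ^ (-2 / (((s + 2 : ℕ) : ℝ) - 2)) = ((k ^ ((1 : ℝ) / s)) ^ 2)⁻¹ := by
  rw [← Real.rpow_natCast, ← Real.rpow_mul hk.le, ← Real.rpow_neg hk.le, Nat.cast_add,
    Nat.cast_ofNat, add_sub_cancel_right]
  congr 1
  ring

theorem rpow_neg_one_div {k : ℝ} (hk : 0 < k) (s : ℕ) :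
    k ^ (-1 / (((s + 2 : ℕ) : ℝ) - 2)) = (k ^ ((1 : ℝ) / s))⁻¹ := by
  rw [← Real.rpow_neg hk.le, Nat.cast_add, Nat.cast_ofNat, add_sub_cancel_right]
  congr 1
  ring

/-- Since δ ≤ n/b, the left side is at most n^{s+3/2}/b^s, which the binomial coefficient exceeds
once √n is at least a constant over b^s; Y encodes that threshold together with n ≥ s + 2. -/
theorem le_choose_of_le_div {s n : ℕ} {b δ Y : ℝ} (hb : 0 < b) (hδ : 0 < δ)
    (hY : Y = 2 * ((s + 2 : ℕ) : ℝ) +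
      ((s + 2 : ℕ) ^ (s + 2) * (s + 2).factorial : ℝ) ^ 2 / b ^ (2 * s))
    (hYδ : Y ≤ b * δ) (hn : b * δ ≤ n) :
    δ ^ s * (n : ℝ) ^ ((3 : ℝ) / 2) ≤ (n.choose (s + 2) : ℝ) := by
  have hh2 := rpow_three_halves_sq n
  set h : ℝ := (n : ℝ) ^ ((3 : ℝ) / 2)
  have hh0 : 0 ≤ h := by positivity
  set a : ℝ := (s + 2 : ℕ) ^ (s + 2) * (s + 2).factorial with ha
  have ha0 : 0 < a := by positivity
  have h1 : 0 ≤ a ^ 2 / b ^ (2 * s) := by positivity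
  have h2 : a ^ 2 / b ^ (2 * s) ≤ n := by
    have : (0 : ℝ) ≤ ((s + 2 : ℕ) : ℝ) := by positivity
    linarith
  rw [div_le_iff₀ (by positivity)] at h2
  have hrn : s + 2 ≤ n := by
    have : ((s + 2 : ℕ) : ℝ) ≤ n := by
      have : (0 : ℝ) ≤ ((s + 2 : ℕ) : ℝ) := by positivity
      linarith
    exact_mod_cast this
  have h3 : a * h ≤ b ^ s * n ^ 2 := by
    apply le_of_sq_le_sq _ (by positivity)
    calc (a * h) ^ 2 = a ^ 2 * n ^ 3 := by rw [mul_pow, hh2]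
      _ ≤ (n * b ^ (2 * s)) * n ^ 3 := by gcongr
      _ = _ := by ring
  have h4 : (n : ℝ) ^ (s + 2) ≤ a * n.choose (s + 2) := pow_le_mul_choose hrn
  refine le_of_mul_le_mul_left ?_ (by positivity : 0 < a * b ^ s)
  calc a * b ^ s * (δ ^ s * h) = (b * δ) ^ s * (a * h) := by ring
    _ ≤ (n : ℝ) ^ s * (b ^ s * n ^ 2) := by gcongr
    _ = b ^ s * n ^ (s + 2) := by ring
    _ ≤ b ^ s * (a * n.choose (s + 2)) := by gcongr
    _ = _ := by ring

/-- A suitable bipartite graph gives a graph with few copies of `K_{2,t}`, and bounds `n` below. -/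
theorem exists_sparse_construction {t s n : ℕ} (ht : 1 ≤ t) (hs : 1 ≤ s) (hn : 1 ≤ n) {k b : ℝ}
    (hb : 0 < b) (hk : 0 < k) (hkb : 2 * ((s + 2 : ℕ) : ℝ) ≤ b * k ^ ((1 : ℝ) / s))
    (hB : ExistsSuitableBipartite t (s + 2) n k b) :
    b * k ^ ((1 : ℝ) / s) ≤ n ∧ ∃ G : SimpleGraph (Fin n),
      (b / 4) ^ (s + 2) / (t * ((s + 2 : ℕ) ^ (s + 2) * (s + 2).factorial)) *
        (k * (n : ℝ) ^ ((3 : ℝ) / 2)) ≤ (numCliques (s + 2) G : ℝ) ∧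
      (numK2 t G : ℝ) ≤ 2 * b ^ (t + 2) * (2 * t) ^ t * sparseBound t (s + 2) n k := by
  obtain ⟨m, B, hBip, hm, he, hpaths⟩ := hB
  rw [sparseBound_eq_pow t s n hk]
  rw [rpow_neg_two_div hk] at hm
  rw [rpow_neg_one_div hk] at he
  have hδs := rpow_one_div_pow hk hs
  set δ : ℝ := k ^ ((1 : ℝ) / s) with hδ
  have hδ0 : 0 < δ := by positivity
  have hn0 : (0 : ℝ) < n := by exact_mod_cast hn
  set h : ℝ := (n : ℝ) ^ ((3 : ℝ) / 2) with hh
  have hh0 : 0 < h := by positivity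
  obtain ⟨H, hH⟩ : ∃ H : ℝ, H = (δ ^ 2)⁻¹ * h := ⟨_, rfl⟩
  have hH0 : 0 < H := by rw [hH]; positivity
  have hHδ : H * δ ^ 2 = h := by rw [hH]; field_simp
  rw [← hH] at hm
  have he1 : b * δ * H ≤ ∑ u, (#(rightNbrs B u) : ℝ) := by
    have h1 : (B.edgeSet.ncard : ℝ) ≤ ∑ u, (#(rightNbrs B u) : ℝ) := by
      exact_mod_cast ncard_edgeSet_le_sum hBip
    refine le_trans (le_of_eq ?_) (he.trans h1)
    rw [hH]; field_simp
  have he2 : ∑ u, (#(rightNbrs B u) : ℝ) ≤ m * n := by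
    have : ∑ u, #(rightNbrs B u) ≤ m * n := by
      have := sum_le_card_nsmul (univ : Finset (Fin m)) (fun u => #(rightNbrs B u)) n
        fun u _ => (card_le_univ _).trans_eq (Fintype.card_fin n)
      simpa using this
    exact_mod_cast this
  -- With m ≤ H this yields H ≥ 1, so rounding the number of chunks up to ⌈H⌉ at most doubles it.
  have hm0 : (1 : ℝ) ≤ m := by
    rcases Nat.eq_zero_or_pos m with h0 | h0
    · have h1 : (m : ℝ) * n = 0 := by rw [h0, Nat.cast_zero, zero_mul]
      have : 0 < b * δ * H := by positivity
      linarith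
    · exact_mod_cast h0
  constructor
  · have h1 : b * δ * H ≤ n * H := by
      calc b * δ * H ≤ m * n := he1.trans he2
        _ ≤ H * n := by gcongr
        _ = _ := mul_comm _ _
    exact le_of_mul_le_mul_right h1 hH0
  -- Half of the guaranteed average degree bδ: the edges fill at least 2H chunks before rounding,
  -- and rounding loses at most one chunk per vertex of U, hence at most H.
  · set q := ⌊b * δ / 2⌋₊ with hq
    have hsR : (0 : ℝ) ≤ s := by positivity
    have hrR : (2 : ℝ) ≤ ((s + 2 : ℕ) : ℝ) := by push_cast; linarith
    have hq2 : (q : ℝ) ≤ b * δ / 2 := Nat.floor_le (by positivity)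
    have hq1 : b * δ / 2 / 2 ≤ q := half_le_natFloor (by linarith)
    have hqr : s + 2 ≤ q := by
      rw [hq, Nat.le_floor_iff (by positivity)]; linarith
    have hq0 : (0 : ℝ) < q := by exact_mod_cast (by omega : 0 < q)
    have hsum : ⌈H⌉₊ ≤ ∑ u, #(rightNbrs B u) / q := by
      rw [Nat.ceil_le]
      refine le_trans ?_ (sum_div_lower_bound (by omega) fun u => #(rightNbrs B u))
      have h1 : 2 * H ≤ (∑ u, (#(rightNbrs B u) : ℝ)) / q := by
        rw [le_div_iff₀ hq0]
        calc 2 * H * q ≤ 2 * H * (b * δ / 2) := by gcongr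
          _ = b * δ * H := by ring
          _ ≤ _ := he1
      linarith
    obtain ⟨D, hD, hDc⟩ := exists_isChunking (by omega : 1 ≤ q) B hsum
    have hbδ : 0 < b * δ := by positivity
    have hceil := Nat.ceil_lt_add_one hH0.le
    have := exists_graph_of_chunking_bounds ht hD hpaths hDc hqr hb hδ0 hH0 (by linarith)
      (by linarith) (Nat.le_ceil H) (by linarith)
    rw [hHδ, hδs] at this
    exact ⟨chunkGraph D, this⟩

theorem exists_conditional_construction {t r : ℕ} (ht : 2 ≤ t) (hr : 2 < r) (hrt : r < 2 + t)
    {b : ℝ} (hb : 0 < b) :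
    ∃ k₁ c C : ℝ, 0 < c ∧ 0 < C ∧ ∀ (n : ℕ) (k : ℝ), 0 < k → k₁ ≤ k →
      ExistsSuitableBipartite t r n k b →
      ∃ G : SimpleGraph (Fin n),
        c * (k * (n : ℝ) ^ ((3 : ℝ) / 2)) ≤ (numCliques r G : ℝ) ∧
        (numK2 t G : ℝ) ≤ C * min (sparseBound t r n k) (denseBound t r n k) := by
  obtain ⟨c₁, C₁, hc₁, hC₁, hdense⟩ := exists_dense_construction ht hr hrt
  obtain ⟨s, rfl⟩ : ∃ s, r = s + 2 := ⟨r - 2, by omega⟩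
  have htR : (2 : ℝ) ≤ t := by exact_mod_cast ht
  obtain ⟨Y, hY⟩ : ∃ Y : ℝ, Y = 2 * ((s + 2 : ℕ) : ℝ) +
      ((s + 2 : ℕ) ^ (s + 2) * (s + 2).factorial : ℝ) ^ 2 / b ^ (2 * s) := ⟨_, rfl⟩
  have hYr : 2 * ((s + 2 : ℕ) : ℝ) ≤ Y := by
    rw [hY]; exact le_add_of_nonneg_right (by positivity)
  have hY0 : 0 ≤ Y := le_trans (by positivity) hYr
  obtain ⟨c₂, hc₂', hc₂⟩ : ∃ c₂ : ℝ, 0 < c₂ ∧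
    c₂ = (b / 4) ^ (s + 2) / (t * ((s + 2 : ℕ) ^ (s + 2) * (s + 2).factorial)) :=
    ⟨_, by positivity, rfl⟩
  obtain ⟨C₂, hC₂', hC₂⟩ : ∃ C₂ : ℝ, 0 < C₂ ∧ C₂ = 2 * b ^ (t + 2) * (2 * t) ^ t :=
    ⟨_, by positivity, rfl⟩
  -- The bound on k amounts to Y ≤ b k^{1/s}; combined with b k^{1/s} ≤ n, read off from the
  -- bipartite graph, it makes k n^{3/2} ≤ C(n, r), as the unconditional construction requires.
  refine ⟨(Y / b) ^ s, min c₁ c₂, max C₁ C₂, lt_min hc₁ hc₂', lt_max_of_lt_left hC₁,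
    fun n k hk hk1 hB => ?_⟩
  have hA0 := sparseBound_nonneg t (s + 2) n hk
  have hD0 := denseBound_nonneg t (s + 2) n hk
  have hmin0 := le_min hA0 hD0
  rcases Nat.eq_zero_or_pos n with rfl | hn
  · refine ⟨⊥, ?_, ?_⟩
    · rw [Nat.cast_zero, Real.zero_rpow (by norm_num), mul_zero, mul_zero]; positivity
    · rw [numK2_eq_zero_of_zero, Nat.cast_zero]
      exact mul_nonneg (le_max_of_le_left hC₁.le) hmin0
  have hδs := rpow_one_div_pow hk (by omega : 1 ≤ s)
  have hYδ : Y ≤ b * k ^ ((1 : ℝ) / s) := by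
    rw [← hδs] at hk1
    have := le_of_pow_le_pow_left₀ (by omega : s ≠ 0) (by positivity) hk1
    rw [div_le_iff₀ hb] at this
    linarith
  obtain ⟨hbn, G, hG1, hG2⟩ := exists_sparse_construction (by omega : 1 ≤ t) (by omega) hn hb hk
    (hYr.trans hYδ) hB
  have hK0 : 0 ≤ k * (n : ℝ) ^ ((3 : ℝ) / 2) := by positivity
  rcases le_total (sparseBound t (s + 2) n k) (denseBound t (s + 2) n k) with h | h
  · rw [min_eq_left h]
    rw [← hc₂] at hG1
    rw [← hC₂] at hG2
    exact ⟨G, (mul_le_mul_of_nonneg_right (min_le_right _ _) hK0).trans hG1,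
      hG2.trans (mul_le_mul_of_nonneg_right (le_max_right _ _) hA0)⟩
  · rw [min_eq_right h]
    have hchoose := le_choose_of_le_div hb (by positivity) hY hYδ hbn
    rw [hδs] at hchoose
    obtain ⟨G, hG1, hG2⟩ := hdense n k hk hchoose
    exact ⟨G, (mul_le_mul_of_nonneg_right (min_le_left _ _) hK0).trans hG1,
      hG2.trans (mul_le_mul_of_nonneg_right (le_max_left _ _) hD0)⟩

theorem mainTheorem1 (t : ℕ) (ht : 2 ≤ t) :
    ∃ k₀ : ℝ, ∀ r : ℕ, 2 < r → r < 2 + t →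
      -- the lower bound
      (∃ c : ℝ, 0 < c ∧ ∀ (n : ℕ) (G : SimpleGraph (Fin n)) (k : ℝ), k₀ ≤ k →
        (numCliques r G : ℝ) = k * (n : ℝ) ^ ((3 : ℝ) / 2) →
        c * min (sparseBound t r n k) (denseBound t r n k) ≤ (numK2 t G : ℝ)) ∧
      -- the unconditional construction
      (∃ c C : ℝ, 0 < c ∧ 0 < C ∧ ∀ (n : ℕ) (k : ℝ), 0 < k →
        k * (n : ℝ) ^ ((3 : ℝ) / 2) ≤ (n.choose r : ℝ) →
        ∃ G : SimpleGraph (Fin n),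
          c * (k * (n : ℝ) ^ ((3 : ℝ) / 2)) ≤ (numCliques r G : ℝ) ∧
          (numK2 t G : ℝ) ≤ C * denseBound t r n k) ∧
      -- the conditional construction
      (∀ b : ℝ, 0 < b → ∃ k₁ c C : ℝ, 0 < c ∧ 0 < C ∧ ∀ (n : ℕ) (k : ℝ), 0 < k → k₁ ≤ k →
        ExistsSuitableBipartite t r n k b →
        ∃ G : SimpleGraph (Fin n),
          c * (k * (n : ℝ) ^ ((3 : ℝ) / 2)) ≤ (numCliques r G : ℝ) ∧
          (numK2 t G : ℝ) ≤ C * min (sparseBound t r n k) (denseBound t r n k)) := by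
  obtain ⟨c, hc, hlower⟩ := exists_lower_bound t ht
  exact ⟨(4 * t ^ 2) ^ t, fun r hr hrt =>
    ⟨⟨c, hc, fun n G k hk hK => hlower r hr hrt n G k hk hK⟩,
      exists_dense_construction ht hr hrt,
      fun _ hb => exists_conditional_construction ht hr hrt hb⟩⟩
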